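/- Let $X_1,X_2,\dots$ be i.i.d. random elements of $\mathcal L^2([0,1]^2)$, distributed as $X$, with $\mathbb E\|X\|_2^4<\infty$ and covariance operator $C=\mathbb E[(X-\mathbb EX)\otimes(X-\mathbb EX)]$. Write $|||\cdot|||_2$ for the Hilbert--Schmidt norm, and for Hilbert--Schmidt operators $A,B$ on $\mathcal L^2([0,1])$ with kernels $a,b$ let $A\,\tilde\otimes\,B$ be the operator on $\mathcal L^2([0,1]^2)$ with kernel $a(t,t')\,b(s,s')$. Let $C=\sum_{i\ge1}\sigma_i\,A_i\,\tilde\otimes\,B_i$ be a separable component decomposition, i.e. $\sigma_1\ge\sigma_2\ge\dots\ge0$ and $(A_i)$ and $(B_i)$ are orthonormal for the Hilbert--Schmidt inner product. Assume that the kernel $c(t,s,t',s')$ of $C$ is $L$-Lipschitz on $[0,1]^4$ for the Euclidean distance. For $K_1,K_2\ge1$ divide $[0,1]^2$ into the $K_1K_2$ pixels $I_{i,j}=T_i\times S_j$ of a regular grid, where $T_i$ and $S_j$ are intervals of lengths $1/K_1$ and $1/K_2$. Let $\mathbf X_n^K\in\mathbb R^{K_1\times K_2}$ be obtained from $X_n$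 in one of the following ways: (1) $X$ has almost surely continuous sample paths and $\mathbf X_n^K[i,j]=X_n(t_i^{K_1},s_j^{K_2})$ for fixed points $t_i^{K_1}\in T_i$, $s_j^{K_2}\in S_j$ (boundary points may be assigned to either adjacent interval); (2) $\mathbf X_n^K[i,j]=|I_{i,j}|^{-1}\iint_{I_{i,j}}X_n(t,s)\,dt\,ds$. Let $X_n^K=\sum_{i,j}\mathbf X_n^K[i,j]\,\mathbf 1_{I_{i,j}}$, let $\widehat C_N^K=N^{-1}\sum_{n=1}^N(X_n^K-\bar X^K)\otimes(X_n^K-\bar X^K)$, where $\bar X^K=N^{-1}\sum_{n=1}^NX_n^K$, and let $\widehat C_{R,N}^K$ be any minimizer of $|||\widehat C_N^K-G|||_2$ over the operators $G$ that are sums of at most $R$ operators of the form $A\,\tilde\otimes\,B$. Let $\alpha_1=\sigma_1^2-\sigma_2^2$, $\alpha_i=\min\{\sigma_{i-1}^2-\sigma_i^2,\ \sigma_i^2-\sigma_{i+1}^2\}$ for $i\ge2$, and $a_R=|||C|||_2\sum_{i=1}^R\sigma_i/\alpha_i$. Then for every $\varepsilon>0$ there is $M$, which may depend on $\varepsilon$,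 $L$, the law of $X$ and the chosen scheme and points, such that for all $R\ge1$ with $\sigma_1>\dots>\sigma_R>\sigma_{R+1}$ and all $N,K_1,K_2\ge1$, with probability at least $1-\varepsilon$, $$\Bigl|\,|||\widehat C_{R,N}^K-C|||_2-\sqrt{\textstyle\sum_{i>R}\sigma_i^2}\,\Bigr|\le\bigl(16a_R+\sqrt2\bigr)L\sqrt{\tfrac1{K_1^2}+\tfrac1{K_2^2}}+\frac{8\sqrt2\,L^2}{|||C|||_2}\Bigl(\tfrac1{K_1^2}+\tfrac1{K_2^2}\Bigr)a_R+M\,\frac{a_R}{\sqrt N}.$$ In other words, the error is the bias $\sqrt{\sum_{i>R}\sigma_i^2}$ up to an $\mathcal O_{\mathbb P}(a_R/\sqrt N)$ term, uniformly in $K_1,K_2$, and the explicit discretization terms. -/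

import Mathlib

open MeasureTheory ProbabilityTheory

namespace SeparableCov

/-! ### Square integrable functions on the unit square and Hilbert--Schmidt kernels -/

/-- The unit square `[0,1]²`; its canonical measure `volume` is Lebesgue measure. -/
abbrev Square : Type := unitInterval × unitInterval

/-- `L²([0,1]²)` with Lebesgue measure. Its elements play two roles: surfaces `x(t,s)`, and
Hilbert--Schmidt operators on `L²([0,1])`, identified with their kernels `a(t,t')`. -/
abbrev LTwoSquare : Type := Lp ℝ 2 (volume : Measure Square)

/-- Hilbert--Schmidt operators on `L²([0,1]²)`, identified with their kernels
`c((t,s),(t',s'))` in `L²([0,1]² × [0,1]²)`. The Hilbert--Schmidt norm is the `L²` norm of the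
kernel, so it is the norm that this space carries. -/
abbrev HSKernel : Type := Lp ℝ 2 (volume : Measure (Square × Square))

noncomputable instance : MeasurableSpace LTwoSquare := borel LTwoSquare

instance : BorelSpace LTwoSquare := ⟨rfl⟩

theorem memLp_tensor (u v : LTwoSquare) :
    MemLp (fun z : Square × Square => u z.1 * v z.2) 2 volume := by
  have hu : MemLp u 2 volume := Lp.memLp u
  have hv : MemLp v 2 volume := Lp.memLp v
  have hm : AEStronglyMeasurable (fun z : Square × Square => u z.1 * v z.2) volume :=
    (hu.1.comp_fst (ν := (volume : Measure Square))).mul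
      (hv.1.comp_snd (μ := (volume : Measure Square)))
  rw [memLp_two_iff_integrable_sq hm]
  have h := Integrable.mul_prod hu.integrable_sq hv.integrable_sq
  refine h.congr (Filter.Eventually.of_forall fun z => ?_)
  simp only [mul_pow]

/-- The rearrangement `((t,s),(t',s')) ↦ ((t,t'),(s,s'))`. -/
def rearrange (z : Square × Square) : Square × Square :=
  ((z.1.1, z.2.1), (z.1.2, z.2.2))

theorem measurePreserving_rearrange : MeasurePreserving rearrange volume volume := by
  have h1 : MeasurePreserving (MeasurableEquiv.prodAssoc :
      (unitInterval × unitInterval) × Square ≃ᵐ unitInterval × (unitInterval × Square))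
      volume volume := volume_preserving_prodAssoc
  have h2 : MeasurePreserving (MeasurableEquiv.prodAssoc :
      (unitInterval × unitInterval) × unitInterval ≃ᵐ unitInterval × Square)
      volume volume := volume_preserving_prodAssoc
  have hid : MeasurePreserving (id : unitInterval → unitInterval) volume volume :=
    MeasurePreserving.id _
  have hsw : MeasurePreserving (Prod.swap : Square → Square) volume volume :=
    Measure.measurePreserving_swap
  have h3 : MeasurePreserving (Prod.map Prod.swap id :
      Square × unitInterval → Square × unitInterval) volume volume := hsw.prod hid
  have h4 : MeasurePreserving (fun w : unitInterval × Square =>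
      MeasurableEquiv.prodAssoc (Prod.map Prod.swap id (MeasurableEquiv.prodAssoc.symm w)))
      volume volume := h2.comp (h3.comp (h2.symm _))
  exact (h1.symm _).comp ((hid.prod h4).comp h1)

theorem memLp_sepProd (A B : LTwoSquare) :
    MemLp (fun z : Square × Square => A (z.1.1, z.2.1) * B (z.1.2, z.2.2)) 2 volume :=
  (memLp_tensor A B).comp_measurePreserving measurePreserving_rearrange

/-- The tensor product `u ⊗ v` of two surfaces: the rank-one operator with kernel
`u(t,s) v(t',s')`. -/
noncomputable def tensor (u v : LTwoSquare) : HSKernel := (memLp_tensor u v).toLp _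

/-- The separable operator built from Hilbert--Schmidt operators `A` and `B` on `L²([0,1])` with
kernels `a(t,t')` and `b(s,s')`: its kernel is `a(t,t') b(s,s')`. -/
noncomputable def sepProd (A B : LTwoSquare) : HSKernel := (memLp_sepProd A B).toLp _

/-! ### Separable component decomposition -/

/-- `C = ∑ i, σ i • (A i ⊗̃ B i)` is a separable component decomposition of `C`: the scores are
nonnegative and nonincreasing, and the `A i`, as well as the `B i`, are orthonormal. The indices
start at `0`, so that `σ i` is the `(i+1)`-st score. -/
structure IsSCD (C : HSKernel) (σ : ℕ → ℝ) (A B : ℕ → LTwoSquare) : Prop where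
  nonneg : ∀ i, 0 ≤ σ i
  antitone : Antitone σ
  orthonormal_left : Orthonormal ℝ A
  orthonormal_right : Orthonormal ℝ B
  hasSum : HasSum (fun i => σ i • sepProd (A i) (B i)) C

/-- The degree-of-separability of `G` is at most `R`: `G` is a sum of `R` separable operators
(equivalently, at most `R` of its separable component scores are nonzero). -/
def DoSLE (R : ℕ) (G : HSKernel) : Prop :=
  ∃ A B : Fin R → LTwoSquare, G = ∑ r, sepProd (A r) (B r)

/-- `G` is a best `R`-separable approximation of `C`, i.e. it minimizes the Hilbert--Schmidt
distance to `C` among all operators of degree-of-separability at most `R`. -/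
def IsBestSepApprox (R : ℕ) (C G : HSKernel) : Prop :=
  DoSLE R G ∧ ∀ G' : HSKernel, DoSLE R G' → ‖C - G‖ ≤ ‖C - G'‖

/-- The spectral gaps `min {σ_{i-1}² - σ_i², σ_i² - σ_{i+1}²}` of the squared scores; for the
leading score only the gap to the next score counts. -/
def gap (σ : ℕ → ℝ) : ℕ → ℝ
  | 0 => σ 0 ^ 2 - σ 1 ^ 2
  | i + 1 => min (σ i ^ 2 - σ (i + 1) ^ 2) (σ (i + 1) ^ 2 - σ (i + 2) ^ 2)

/-- The constant `a_R = ‖C‖ ∑_{i ≤ R} σ_i / α_i`, where `α_i` are the spectral gaps. -/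
noncomputable def aConst (C : HSKernel) (σ : ℕ → ℝ) (R : ℕ) : ℝ :=
  ‖C‖ * ∑ i ∈ Finset.range R, σ i / gap σ i

/-- The bias `√(∑_{i > R} σ_i²)`. -/
noncomputable def bias (σ : ℕ → ℝ) (R : ℕ) : ℝ := √(∑' i, σ (R + i) ^ 2)

/-! ### Covariance and empirical covariance -/

/-- The covariance `E[(X - EX) ⊗ (X - EX)]` of a random surface, with Bochner expectations. -/
noncomputable def covariance {Ω : Type*} [MeasurableSpace Ω] (P : Measure Ω)
    (X : Ω → LTwoSquare) : HSKernel :=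
  ∫ ω, tensor (X ω - ∫ ω', X ω' ∂P) (X ω - ∫ ω', X ω' ∂P) ∂P

/-- The empirical covariance `N⁻¹ ∑ₙ (Yₙ - Ȳ) ⊗ (Yₙ - Ȳ)` of `Y 0, …, Y (N - 1)`. -/
noncomputable def empiricalCov (N : ℕ) (Y : ℕ → LTwoSquare) : HSKernel :=
  (N : ℝ)⁻¹ • ∑ n ∈ Finset.range N,
    tensor (Y n - (N : ℝ)⁻¹ • ∑ m ∈ Finset.range N, Y m)
      (Y n - (N : ℝ)⁻¹ • ∑ m ∈ Finset.range N, Y m)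

/-- `k` is `L`-Lipschitz on `[0,1]⁴` for the Euclidean distance. -/
def IsLipschitzKernel (L : ℝ) (k : Square × Square → ℝ) : Prop :=
  ∀ z w : Square × Square, |k z - k w| ≤
    L * √(((z.1.1 : ℝ) - w.1.1) ^ 2 + ((z.1.2 : ℝ) - w.1.2) ^ 2
      + ((z.2.1 : ℝ) - w.2.1) ^ 2 + ((z.2.2 : ℝ) - w.2.2) ^ 2)

/-! ### Pixels and measurement schemes -/

/-- The `i`-th cell of the regular partition of `[0,1]` into `K` intervals of length `1/K`:
`[i/K, (i+1)/K)`, where the last cell also contains the point `1`. -/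
def cell (K : ℕ) (i : Fin K) : Set unitInterval :=
  {t | (i : ℝ) / K ≤ t ∧ ((t : ℝ) < ((i : ℝ) + 1) / K ∨ (i : ℕ) + 1 = K)}

theorem measurableSet_cell (K : ℕ) (i : Fin K) : MeasurableSet (cell K i) := by
  refine (measurableSet_le measurable_const measurable_subtype_coe).inter ?_
  exact (measurableSet_lt measurable_subtype_coe measurable_const).union (MeasurableSet.const _)

/-- The `(i,j)`-th pixel of the `K₁ × K₂` grid. -/
def pixel (K₁ K₂ : ℕ) (i : Fin K₁) (j : Fin K₂) : Set Square := cell K₁ i ×ˢ cell K₂ j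

theorem measurableSet_pixel (K₁ K₂ : ℕ) (i : Fin K₁) (j : Fin K₂) :
    MeasurableSet (pixel K₁ K₂ i j) :=
  (measurableSet_cell K₁ i).prod (measurableSet_cell K₂ j)

/-- The pixelated surface that takes the constant value `M i j` on the `(i,j)`-th pixel. -/
noncomputable def pixelate {K₁ K₂ : ℕ} (M : Matrix (Fin K₁) (Fin K₂) ℝ) : LTwoSquare :=
  ∑ i, ∑ j, M i j •
    indicatorConstLp 2 (measurableSet_pixel K₁ K₂ i j) (measure_ne_top volume _) (1 : ℝ)

/-- `t` picks, for every grid size `K`, one point in every cell of the regular partition. The cells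
are closed here, so that points on the boundary between two cells may be assigned to either. -/
def IsGridChoice (t : (K : ℕ) → Fin K → unitInterval) : Prop :=
  ∀ (K : ℕ) (i : Fin K), (i : ℝ) / K ≤ t K i ∧ (t K i : ℝ) ≤ ((i : ℝ) + 1) / K

/-- The surfaces `X n` almost surely have continuous sample paths, and the measurements
`D K₁ K₂ n` are the values of these paths at the points `(t_i, s_j)`. -/
def PointwiseScheme {Ω : Type*} [MeasurableSpace Ω] (P : Measure Ω) (X : ℕ → Ω → LTwoSquare)
    (t s : (K : ℕ) → Fin K → unitInterval)
    (D : (K₁ K₂ : ℕ) → ℕ → Ω → Matrix (Fin K₁) (Fin K₂) ℝ) : Prop :=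
  ∀ n, ∀ᵐ ω ∂P, ∃ x : C(Square, ℝ), X n ω =ᵐ[volume] x ∧
    ∀ (K₁ K₂ : ℕ) (i : Fin K₁) (j : Fin K₂), D K₁ K₂ n ω i j = x (t K₁ i, s K₂ j)

/-- The measurements `D K₁ K₂ n` are the averages of the surface `X n` over the pixels. -/
def AverageScheme {Ω : Type*} [MeasurableSpace Ω] (P : Measure Ω) (X : ℕ → Ω → LTwoSquare)
    (D : (K₁ K₂ : ℕ) → ℕ → Ω → Matrix (Fin K₁) (Fin K₂) ℝ) : Prop :=
  ∀ n, ∀ᵐ ω ∂P, ∀ (K₁ K₂ : ℕ) (i : Fin K₁) (j : Fin K₂),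
    D K₁ K₂ n ω i j = ((volume : Measure Square).real (pixel K₁ K₂ i j))⁻¹ *
      ∫ p in pixel K₁ K₂ i j, X n ω p

end SeparableCov

namespace SeparableCov

open scoped RealInnerProductSpace
open Filter Topology

/-! ### Algebra of tensor products -/

/-! No spectral perturbation theory is needed. By an Eckart–Young argument
(`IsSCD.sum_tail_le_norm_sub_sq`) the bias is exactly the Hilbert–Schmidt distance from C to the
operators of degree-of-separability at most R. Minimality of the estimator and the triangle
inequality then bound | ‖Ĉ_R - C‖ - bias | by 2 ‖Ĉ - C‖, where Ĉ is the empirical covariance of the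
pixelated surfaces (`IsSCD.abs_norm_sub_sub_bias_le`). Write η = √(1/K₁² + 1/K₂²). Since a_R ≥ 1
(`IsSCD.one_le_aConst`), it suffices that ‖Ĉ - C‖ ≤ (√2 + 1) L η + M/√N outside an event of
probability ε, with M independent of the grid. The term in L² is nonnegative and can be dropped.

The covariance of a pixelated surface is constant on products of pixels, with values within √2 L η
of the Lipschitz kernel; this is the deterministic part of the error.

The difficulty is to control the fluctuations uniformly in the grid: the fourth moment of ‖X‖ says
nothing about fourth moments of point values, and only second moments are controlled, through the
kernel. Every measurement is therefore written as a limit of averages over boxes inside its pixel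
(`IsSampling`): boxes shrinking to the measurement point, or the constant box for pixel averages.
The variance of the difference of two such averages is a second difference of the kernel near the
diagonal, so the averages are Cauchy in L², with squared error at most 6 L η / (k + 1) when the
boxes have relative size 1/(k + 1).

Fix k depending on ε only. The centered pixelated surface F is then close to the G built from the
k-th boxes: ‖G‖ ≤ (k + 1) ‖X - EX‖ has a fourth moment, while F - G has a small second moment. Where
‖F - G‖ ≤ ‖G‖, the tensor F ⊗ F has a second moment bounded uniformly in the grid, and Chebyshev
gives the rate 1/√N. Elsewhere ‖F ⊗ F‖ ≤ 4 ‖F - G‖², and Markov alone gives an error L η + 1/√N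
(`prob_empiricalCov_sub_le`). -/

theorem tensor_coeFn (u v : LTwoSquare) :
    (tensor u v : Square × Square → ℝ) =ᵐ[volume] fun z => u z.1 * v z.2 :=
  MemLp.coeFn_toLp _

theorem sepProd_coeFn (A B : LTwoSquare) :
    (sepProd A B : Square × Square → ℝ) =ᵐ[volume]
      fun z => A (z.1.1, z.2.1) * B (z.1.2, z.2.2) :=
  MemLp.coeFn_toLp _

/-- Permuting the arguments of the kernel is an isometry that turns rank-one tensors into separable
operators, so degree-of-separability becomes ordinary rank and inner products carry over. -/
theorem sepProd_eq_compMeasurePreserving (A B : LTwoSquare) :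
    sepProd A B = Lp.compMeasurePreserving rearrange measurePreserving_rearrange (tensor A B) := by
  refine Lp.ext ?_
  have h := measurePreserving_rearrange.quasiMeasurePreserving.ae_eq_comp (tensor_coeFn A B)
  filter_upwards [sepProd_coeFn A B,
    Lp.coeFn_compMeasurePreserving (tensor A B) measurePreserving_rearrange, h] with z h1 h2 h3
  rw [h1, h2, h3]
  rfl

theorem ae_fst {f g : Square → ℝ} (h : f =ᵐ[volume] g) :
    (fun z : Square × Square => f z.1) =ᵐ[volume] fun z => g z.1 :=
  (Measure.quasiMeasurePreserving_fst (μ := (volume : Measure Square))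
    (ν := (volume : Measure Square))).ae_eq_comp h

theorem ae_snd {f g : Square → ℝ} (h : f =ᵐ[volume] g) :
    (fun z : Square × Square => f z.2) =ᵐ[volume] fun z => g z.2 :=
  (Measure.quasiMeasurePreserving_snd (μ := (volume : Measure Square))
    (ν := (volume : Measure Square))).ae_eq_comp h

theorem tensor_add_left (u u' v : LTwoSquare) :
    tensor (u + u') v = tensor u v + tensor u' v := by
  refine Lp.ext ?_
  filter_upwards [tensor_coeFn (u + u') v, tensor_coeFn u v, tensor_coeFn u' v,
    Lp.coeFn_add (tensor u v) (tensor u' v), ae_fst (Lp.coeFn_add u u')] with z h1 h2 h3 h4 h5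
  simp only [Pi.add_apply] at h4 h5
  rw [h1, h4, h2, h3, h5, add_mul]

theorem tensor_add_right (u v v' : LTwoSquare) :
    tensor u (v + v') = tensor u v + tensor u v' := by
  refine Lp.ext ?_
  filter_upwards [tensor_coeFn u (v + v'), tensor_coeFn u v, tensor_coeFn u v',
    Lp.coeFn_add (tensor u v) (tensor u v'), ae_snd (Lp.coeFn_add v v')] with z h1 h2 h3 h4 h5
  simp only [Pi.add_apply] at h4 h5
  rw [h1, h4, h2, h3, h5, mul_add]

theorem tensor_smul_left (a : ℝ) (u v : LTwoSquare) : tensor (a • u) v = a • tensor u v := by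
  refine Lp.ext ?_
  filter_upwards [tensor_coeFn (a • u) v, tensor_coeFn u v, Lp.coeFn_smul a (tensor u v),
    ae_fst (Lp.coeFn_smul a u)] with z h1 h2 h3 h4
  simp only [Pi.smul_apply, smul_eq_mul] at h3 h4
  rw [h1, h3, h2, h4, mul_assoc]

theorem tensor_smul_right (a : ℝ) (u v : LTwoSquare) : tensor u (a • v) = a • tensor u v := by
  refine Lp.ext ?_
  filter_upwards [tensor_coeFn u (a • v), tensor_coeFn u v, Lp.coeFn_smul a (tensor u v),
    ae_snd (Lp.coeFn_smul a v)] with z h1 h2 h3 h4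
  simp only [Pi.smul_apply, smul_eq_mul] at h3 h4
  rw [h1, h3, h2, h4, mul_left_comm]

theorem inner_tensor (u v u' v' : LTwoSquare) :
    ⟪tensor u v, tensor u' v'⟫ = ⟪u, u'⟫ * ⟪v, v'⟫ := by
  have h := integral_prod_mul (μ := (volume : Measure Square)) (ν := (volume : Measure Square))
    (fun p => ⟪u p, u' p⟫) (fun p => ⟪v p, v' p⟫)
  rw [L2.inner_def, L2.inner_def, L2.inner_def, ← h]
  refine integral_congr_ae ?_
  have h1 := tensor_coeFn u v
  have h2 := tensor_coeFn u' v'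
  filter_upwards [h1, h2] with z h1 h2
  rw [h1, h2]
  simp only [RCLike.inner_apply, conj_trivial]
  ring

theorem norm_tensor (u v : LTwoSquare) : ‖tensor u v‖ = ‖u‖ * ‖v‖ := by
  rw [← sq_eq_sq₀ (norm_nonneg _) (by positivity), mul_pow, ← real_inner_self_eq_norm_sq,
    ← real_inner_self_eq_norm_sq, ← real_inner_self_eq_norm_sq, inner_tensor]

/-- The tensor product as a continuous bilinear map. -/
noncomputable def tensorL : LTwoSquare →L[ℝ] LTwoSquare →L[ℝ] HSKernel :=
  LinearMap.mkContinuous₂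
    (LinearMap.mk₂ ℝ tensor tensor_add_left tensor_smul_left tensor_add_right tensor_smul_right) 1
    fun u v => by simp [norm_tensor]

theorem tensorL_apply (u v : LTwoSquare) : tensorL u v = tensor u v := rfl

theorem continuous_tensor_self : Continuous fun u : LTwoSquare => tensor u u :=
  tensorL.continuous.clm_apply continuous_id

theorem sepProd_smul_left (a : ℝ) (u v : LTwoSquare) :
    sepProd (a • u) v = a • sepProd u v := by
  simp only [sepProd_eq_compMeasurePreserving, tensor_smul_left]
  exact (Lp.compMeasurePreservingₗ ℝ rearrange measurePreserving_rearrange).map_smul a _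

theorem inner_sepProd (A B A' B' : LTwoSquare) :
    ⟪sepProd A B, sepProd A' B'⟫ = ⟪A, A'⟫ * ⟪B, B'⟫ := by
  simp only [sepProd_eq_compMeasurePreserving]
  rw [← inner_tensor]
  exact LinearIsometry.inner_map_map (𝕜 := ℝ)
    (Lp.compMeasurePreservingₗᵢ ℝ rearrange measurePreserving_rearrange : HSKernel →ₗᵢ[ℝ] HSKernel)
    (tensor A B) (tensor A' B')

/-! ### Best separable approximation -/

theorem IsSCD.orthonormal {C : HSKernel} {σ : ℕ → ℝ} {A B : ℕ → LTwoSquare}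
    (h : IsSCD C σ A B) : Orthonormal ℝ fun i => sepProd (A i) (B i) := by
  rw [orthonormal_iff_ite]
  intro i j
  rw [inner_sepProd, orthonormal_iff_ite.1 h.orthonormal_left i j,
    orthonormal_iff_ite.1 h.orthonormal_right i j]
  split_ifs <;> simp

theorem hasSum_sq_of_orthonormal {H : Type*} [NormedAddCommGroup H] [InnerProductSpace ℝ H]
    {e : ℕ → H} (he : Orthonormal ℝ e) {a : ℕ → ℝ} {x : H}
    (hx : HasSum (fun i => a i • e i) x) : HasSum (fun i => a i ^ 2) (‖x‖ ^ 2) := by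
  have h1 : ∀ j, ⟪e j, x⟫ = a j := by
    intro j
    have h := hx.mapL (innerSL ℝ (e j))
    simp only [innerSL_apply_apply, inner_smul_right, orthonormal_iff_ite.1 he] at h
    refine h.unique ?_
    have h' := hasSum_ite_eq j (a j)
    convert! h' using 2 with i
    by_cases hij : i = j
    · simp [hij]
    · simp [hij, Ne.symm hij]
  have h := hx.mapL (innerSL ℝ x)
  simp only [innerSL_apply_apply, inner_smul_right, real_inner_self_eq_norm_sq] at h
  refine h.congr_fun fun i => ?_
  rw [real_inner_comm, h1, sq]

section Approximation

variable {C : HSKernel} {σ : ℕ → ℝ} {A B : ℕ → LTwoSquare}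

theorem IsSCD.hasSum_sq (h : IsSCD C σ A B) : HasSum (fun i => σ i ^ 2) (‖C‖ ^ 2) :=
  hasSum_sq_of_orthonormal h.orthonormal h.hasSum

theorem IsSCD.exists_doSLE_norm_sub_eq_bias (h : IsSCD C σ A B) (R : ℕ) :
    ∃ G, DoSLE R G ∧ ‖C - G‖ = bias σ R := by
  refine ⟨∑ i ∈ Finset.range R, σ i • sepProd (A i) (B i),
    ⟨fun r => σ r • A r, fun r => B r, ?_⟩, ?_⟩
  · simp only [sepProd_smul_left]
    exact Finset.sum_range fun i => σ i • sepProd (A i) (B i)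
  · have h1 := (hasSum_nat_add_iff' R).2 h.hasSum
    have h2 := hasSum_sq_of_orthonormal (h.orthonormal.comp (fun i => i + R)
      (add_left_injective R)) (a := fun i => σ (i + R)) h1
    rw [bias]
    simp only [add_comm R]
    rw [h2.tsum_eq, Real.sqrt_sq (norm_nonneg _)]

/-- Bathtub principle: a total weight of at most R, with at most 1 per index, removes most when it
sits on the R largest terms. Each term is compared with the threshold `s R`. -/
theorem sum_tail_le_sum_mul_one_sub {s t : ℕ → ℝ} (hs : Antitone s) (hs0 : ∀ i, 0 ≤ s i)
    (ht0 : ∀ i, 0 ≤ t i) (ht1 : ∀ i, t i ≤ 1) {R n : ℕ}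
    (ht : ∑ i ∈ Finset.range (R + n), t i ≤ R) :
    ∑ i ∈ Finset.range n, s (R + i) ≤ ∑ i ∈ Finset.range (R + n), s i * (1 - t i) := by
  rw [Finset.sum_range_add] at ht ⊢
  have h1 : s R * (R - ∑ i ∈ Finset.range R, t i) ≤
      ∑ i ∈ Finset.range R, s i * (1 - t i) := by
    have : (R : ℝ) - ∑ i ∈ Finset.range R, t i = ∑ i ∈ Finset.range R, (1 - t i) := by
      simp [Finset.sum_sub_distrib]
    rw [this, Finset.mul_sum]
    refine Finset.sum_le_sum fun i hi => mul_le_mul_of_nonneg_right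
      (hs (Finset.mem_range.1 hi).le) (by linarith [ht1 i])
  have h2 : ∑ i ∈ Finset.range n, s (R + i) - s R * ∑ i ∈ Finset.range n, t (R + i) ≤
      ∑ i ∈ Finset.range n, s (R + i) * (1 - t (R + i)) := by
    rw [Finset.mul_sum, ← Finset.sum_sub_distrib]
    refine Finset.sum_le_sum fun i _ => ?_
    have := mul_le_mul_of_nonneg_right (hs (Nat.le_add_right R i)) (ht0 (R + i))
    linarith
  have h3 := mul_nonneg (hs0 R) (sub_nonneg.2 ht)
  linarith

/-- Expand in an orthonormal basis of `U`, exchange the sums, and apply Bessel's inequality to each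
basis vector. -/
theorem sum_norm_starProjection_sq_le {H : Type*} [NormedAddCommGroup H] [InnerProductSpace ℝ H]
    (U : Submodule ℝ H) [FiniteDimensional ℝ U] {a : ℕ → H} (ha : Orthonormal ℝ a) (m : ℕ) :
    ∑ i ∈ Finset.range m, ‖U.starProjection (a i)‖ ^ 2 ≤ Module.finrank ℝ U := by
  let b := stdOrthonormalBasis ℝ U
  have h1 : ∀ i, ‖U.starProjection (a i)‖ ^ 2 = ∑ k, ⟪a i, (b k : H)⟫ ^ 2 := by
    intro i
    have h4 := b.sum_sq_norm_inner_right (U.orthogonalProjectionOnto (a i))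
    rw [Submodule.starProjection_apply]
    refine h4.symm.trans (Finset.sum_congr rfl fun k _ => ?_)
    rw [Real.norm_eq_abs, sq_abs, U.inner_orthogonalProjectionOnto_eq_of_mem_left,
      real_inner_comm]
  calc ∑ i ∈ Finset.range m, ‖U.starProjection (a i)‖ ^ 2
      = ∑ k, ∑ i ∈ Finset.range m, ⟪a i, (b k : H)⟫ ^ 2 := by
        rw [Finset.sum_comm]
        exact Finset.sum_congr rfl fun i _ => h1 i
    _ ≤ ∑ k, (1 : ℝ) := by
        refine Finset.sum_le_sum fun k _ => ?_
        have h5 := ha.sum_inner_products_le (b k : H) (s := Finset.range m)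
        have h6 : ‖(b k : H)‖ = 1 := b.orthonormal.1 k
        simpa [h6] using h5
    _ = Module.finrank ℝ U := by simp

theorem norm_sub_starProjection_sq {H : Type*} [NormedAddCommGroup H] [InnerProductSpace ℝ H]
    (U : Submodule ℝ H) [U.HasOrthogonalProjection] (a : H) :
    ‖a - U.starProjection a‖ ^ 2 = ‖a‖ ^ 2 - ‖U.starProjection a‖ ^ 2 := by
  rw [Submodule.norm_sq_eq_add_norm_sq_starProjection a U, Submodule.starProjection_orthogonal]
  simp

/-- The lower half of Eckart–Young, by duality: `C - G` is tested against an operator that is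
orthogonal to `G` because its left factors are orthogonal to those of `G`. Finite partial sums
suffice and avoid convergence questions. -/
theorem IsSCD.sum_tail_le_norm_sub_sq (h : IsSCD C σ A B) {R : ℕ} {G : HSKernel}
    (hG : DoSLE R G) (n : ℕ) :
    ∑ i ∈ Finset.range n, σ (R + i) ^ 2 ≤ ‖C - G‖ ^ 2 := by
  obtain ⟨A', B', rfl⟩ := hG
  set U : Submodule ℝ LTwoSquare := Submodule.span ℝ (Set.range A') with hU
  have hfin : FiniteDimensional ℝ U := FiniteDimensional.span_of_finite ℝ (Set.finite_range A')
  have hdim : Module.finrank ℝ U ≤ R :=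
    (finrank_range_le_card (R := ℝ) A').trans_eq (Fintype.card_fin R)
  set t : ℕ → ℝ := fun i => ‖U.starProjection (A i)‖ ^ 2 with ht
  set p : ℕ → LTwoSquare := fun i => A i - U.starProjection (A i) with hp
  have horth : ∀ i, ∀ w ∈ U, ⟪w, p i⟫ = 0 := fun i w hw => by
    rw [real_inner_comm]
    exact U.starProjection_inner_eq_zero (A i) w hw
  have hpA : ∀ i, ‖p i‖ ^ 2 = 1 - t i := by
    intro i
    rw [norm_sub_starProjection_sq, h.orthonormal_left.1 i, one_pow]
  have hAp : ∀ i, ⟪A i, p i⟫ = ‖p i‖ ^ 2 := by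
    intro i
    have h3 : ⟪p i, p i⟫ = ⟪A i, p i⟫ - ⟪U.starProjection (A i), p i⟫ := by
      rw [← inner_sub_left]
    rw [← real_inner_self_eq_norm_sq, h3, horth i _ (U.starProjection_apply_mem _), sub_zero]
  have htsum : ∀ m, ∑ i ∈ Finset.range m, t i ≤ R := fun m =>
    (sum_norm_starProjection_sq_le U h.orthonormal_left m).trans (by exact_mod_cast hdim)
  -- The test operator: `C` cut at `R + n` terms, with its left factors projected onto the
  -- complement of `U`. It satisfies ⟪G, W⟫ = 0 and ⟪C, W⟫ = ‖W‖² = S, so Cauchy–Schwarz gives S ≤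
  -- ‖C - G‖².
  set W : HSKernel := ∑ i ∈ Finset.range (R + n), σ i • sepProd (p i) (B i) with hW
  set S : ℝ := ∑ i ∈ Finset.range (R + n), σ i ^ 2 * (1 - t i) with hS
  have hBB : ∀ i j, ⟪B i, B j⟫ = if i = j then (1 : ℝ) else 0 :=
    orthonormal_iff_ite.1 h.orthonormal_right
  have hGW : ⟪∑ r, sepProd (A' r) (B' r), W⟫ = (0 : ℝ) := by
    rw [sum_inner]
    refine Finset.sum_eq_zero fun r _ => ?_
    rw [hW, inner_sum]
    refine Finset.sum_eq_zero fun i _ => ?_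
    rw [inner_smul_right, inner_sepProd, horth i _ (Submodule.subset_span ⟨r, rfl⟩)]
    simp
  have hWW : ⟪W, W⟫ = S := by
    rw [hW, sum_inner]
    refine Finset.sum_congr rfl fun i hi => ?_
    rw [inner_sum, Finset.sum_eq_single i]
    · rw [inner_smul_left, inner_smul_right, inner_sepProd, hBB, if_pos rfl,
        real_inner_self_eq_norm_sq, hpA]
      simp only [conj_trivial]
      ring
    · intro j _ hj
      rw [inner_smul_left, inner_smul_right, inner_sepProd, hBB, if_neg (Ne.symm hj)]
      simp
    · exact fun h => absurd hi h
  have hCW : ⟪C, W⟫ = S := by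
    rw [hW, inner_sum]
    refine Finset.sum_congr rfl fun i _ => ?_
    rw [inner_smul_right]
    have h7 := h.hasSum.mapL (innerSL ℝ (sepProd (p i) (B i)))
    simp only [innerSL_apply_apply, inner_smul_right, inner_sepProd, hBB] at h7
    have h8 : ⟪sepProd (p i) (B i), C⟫ = σ i * ‖p i‖ ^ 2 := by
      refine h7.unique ?_
      have h9 := hasSum_ite_eq i (σ i * ‖p i‖ ^ 2)
      refine h9.congr_fun fun j => ?_
      by_cases hij : i = j
      · subst hij
        simp [real_inner_comm, hAp]
      · simp [hij, Ne.symm hij]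
    rw [real_inner_comm, h8, hpA]
    ring
  have hSle : S ≤ ‖C - ∑ r, sepProd (A' r) (B' r)‖ ^ 2 := by
    have h10 : S ≤ ‖C - ∑ r, sepProd (A' r) (B' r)‖ * ‖W‖ := by
      refine le_trans (le_of_eq ?_) (real_inner_le_norm _ _)
      rw [inner_sub_left, hGW, hCW, sub_zero]
    have h11 : ‖W‖ ^ 2 = S := by rw [← real_inner_self_eq_norm_sq, hWW]
    nlinarith [sq_nonneg (‖C - ∑ r, sepProd (A' r) (B' r)‖ - ‖W‖)]
  refine le_trans (sum_tail_le_sum_mul_one_sub (s := fun i => σ i ^ 2) (t := t) ?_ ?_ ?_ ?_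
    (htsum _)) hSle
  · exact fun i j hij => pow_le_pow_left₀ (h.nonneg j) (h.antitone hij) 2
  · exact fun i => sq_nonneg _
  · exact fun i => sq_nonneg _
  · exact fun i => by linarith [hpA i, sq_nonneg ‖p i‖]

theorem IsSCD.bias_le_norm_sub (h : IsSCD C σ A B) {R : ℕ} {G : HSKernel} (hG : DoSLE R G) :
    bias σ R ≤ ‖C - G‖ := by
  rw [bias]
  refine Real.sqrt_le_iff.2 ⟨norm_nonneg _, ?_⟩
  exact Real.tsum_le_of_sum_range_le (fun i => sq_nonneg _) (h.sum_tail_le_norm_sub_sq hG)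

/-- The error is never below the bias. Conversely, pass from `C` to `D`, replace `G` by the
truncation of the decomposition of `C`, and pass back: two passages, hence the factor 2. -/
theorem IsSCD.abs_norm_sub_sub_bias_le (h : IsSCD C σ A B) {R : ℕ} {D G : HSKernel}
    (hG : IsBestSepApprox R D G) : |‖G - C‖ - bias σ R| ≤ 2 * ‖D - C‖ := by
  obtain ⟨G', hG', hb⟩ := h.exists_doSLE_norm_sub_eq_bias R
  have h1 := h.bias_le_norm_sub hG.1
  have h2 := hG.2 G' hG'
  have h3 := norm_sub_le_norm_sub_add_norm_sub C D G
  have h4 := norm_sub_le_norm_sub_add_norm_sub D C G'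
  rw [norm_sub_rev G C, abs_of_nonneg (by linarith)]
  rw [norm_sub_rev C D] at h3
  linarith

/-- The leading term suffices: ‖C‖ ≥ σ₀ and the first gap is at most σ₀². The strict decrease makes
the other terms positive. This lets a_R absorb absolute constants in the final bound. -/
theorem IsSCD.one_le_aConst (h : IsSCD C σ A B) {R : ℕ} (hR : 1 ≤ R)
    (hσ : ∀ i < R, σ (i + 1) < σ i) : 1 ≤ aConst C σ R := by
  have hpos : ∀ i < R, 0 < σ i := fun i hi => (h.nonneg _).trans_lt (hσ i hi)
  have hsq : ∀ i < R, 0 < σ i ^ 2 - σ (i + 1) ^ 2 := fun i hi =>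
    sub_pos.2 (pow_lt_pow_left₀ (hσ i hi) (h.nonneg _) two_ne_zero)
  have hgap : ∀ i < R, 0 < gap σ i := by
    intro i hi
    cases i with
    | zero => exact hsq 0 hi
    | succ i => exact lt_min (hsq i (by omega)) (hsq (i + 1) hi)
  have hC : σ 0 ≤ ‖C‖ := by
    have h2 : σ 0 ^ 2 ≤ ‖C‖ ^ 2 := le_hasSum h.hasSum_sq 0 fun _ _ => sq_nonneg _
    exact (sq_le_sq₀ (h.nonneg 0) (norm_nonneg _)).1 h2
  have h0 : 0 < σ 0 := hpos 0 (by omega)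
  have h3 : 1 / σ 0 ≤ σ 0 / gap σ 0 := by
    rw [div_le_div_iff₀ h0 (hgap 0 (by omega))]
    have : gap σ 0 = σ 0 ^ 2 - σ 1 ^ 2 := rfl
    nlinarith [sq_nonneg (σ 1)]
  have h4 : σ 0 / gap σ 0 ≤ ∑ i ∈ Finset.range R, σ i / gap σ i :=
    Finset.single_le_sum (f := fun i => σ i / gap σ i)
      (fun i hi => (div_pos (hpos i (Finset.mem_range.1 hi)) (hgap i (Finset.mem_range.1 hi))).le)
      (Finset.mem_range.2 (by omega))
  calc (1 : ℝ) = σ 0 * (1 / σ 0) := by field_simp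
    _ ≤ ‖C‖ * ∑ i ∈ Finset.range R, σ i / gap σ i :=
        mul_le_mul hC (h3.trans h4) (by positivity) (norm_nonneg _)

end Approximation

/-! ### Laws of large numbers for random elements of Hilbert spaces -/

section LawOfLargeNumbers

variable {Ω E H : Type*} [MeasurableSpace Ω] {P : Measure Ω}
  [MeasurableSpace E] [NormedAddCommGroup H] {X : ℕ → Ω → E}

theorem memLp_comp_of_identDistrib (hident : ∀ n, IdentDistrib (X n) (X 0) P P) {φ : E → H}
    (hφ : StronglyMeasurable φ) {p : ENNReal} (hL : MemLp (fun ω => φ (X 0 ω)) p P) (n : ℕ) :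
    MemLp (fun ω => φ (X n ω)) p P := by
  have h0 := (hident 0).aemeasurable_fst
  have hn := (hident n).aemeasurable_fst
  have h1 : MemLp φ p (P.map (X 0)) :=
    (memLp_map_measure_iff hφ.aestronglyMeasurable h0).2 hL
  rw [← (hident n).map_eq] at h1
  exact (memLp_map_measure_iff hφ.aestronglyMeasurable hn).1 h1

theorem integral_comp_of_identDistrib [NormedSpace ℝ H]
    (hident : ∀ n, IdentDistrib (X n) (X 0) P P) {φ : E → H}
    (hφ : StronglyMeasurable φ) (n : ℕ) :
    ∫ ω, φ (X n ω) ∂P = ∫ ω, φ (X 0 ω) ∂P := by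
  rw [← integral_map (hident n).aemeasurable_fst hφ.aestronglyMeasurable, (hident n).map_eq,
    integral_map (hident 0).aemeasurable_fst hφ.aestronglyMeasurable]

variable [IsProbabilityMeasure P] [InnerProductSpace ℝ H]

/-- Independence and centering kill the off-diagonal inner products in the expanded square. -/
theorem integral_norm_mean_sq_le [CompleteSpace H] (hindep : iIndepFun X P)
    (hident : ∀ n, IdentDistrib (X n) (X 0) P P) {φ : E → H} (hφ : StronglyMeasurable φ)
    (hL : MemLp (fun ω => φ (X 0 ω)) 2 P) (h0 : ∫ ω, φ (X 0 ω) ∂P = 0) (N : ℕ) :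
    Integrable (fun ω => ‖(N : ℝ)⁻¹ • ∑ n ∈ Finset.range N, φ (X n ω)‖ ^ 2) P ∧
    ∫ ω, ‖(N : ℝ)⁻¹ • ∑ n ∈ Finset.range N, φ (X n ω)‖ ^ 2 ∂P ≤
      (N : ℝ)⁻¹ * ∫ ω, ‖φ (X 0 ω)‖ ^ 2 ∂P := by
  have hLn : ∀ n, MemLp (fun ω => φ (X n ω)) 2 P := memLp_comp_of_identDistrib hident hφ hL
  have hint : ∀ n, Integrable (fun ω => φ (X n ω)) P := fun n =>
    (hLn n).integrable one_le_two
  have hcross : ∀ n k, Integrable (fun ω => ⟪φ (X n ω), φ (X k ω)⟫) P := fun n k =>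
    ((hLn n).norm.integrable_mul (hLn k).norm).mono' ((hLn n).1.inner (hLn k).1)
      (Eventually.of_forall fun ω => norm_inner_le_norm _ _)
  have hoff : ∀ n k, n ≠ k → ∫ ω, ⟪φ (X n ω), φ (X k ω)⟫ ∂P = 0 := by
    intro n k hnk
    have hn := (hident n).aemeasurable_fst
    have hk := (hident k).aemeasurable_fst
    have h : ∫ ω, ⟪φ (X n ω), φ (X k ω)⟫ ∂P = ⟪∫ ω, φ (X n ω) ∂P, ∫ ω, φ (X k ω) ∂P⟫ :=
      (hindep.indepFun hnk).integral_bilin_comp_comp hn hk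
        ((integrable_map_measure hφ.aestronglyMeasurable hn).2 (hint n))
        ((integrable_map_measure hφ.aestronglyMeasurable hk).2 (hint k)) (innerSL ℝ (E := H))
    rw [h, integral_comp_of_identDistrib hident hφ n, h0, inner_zero_left]
  have hdiag : ∀ n, ∫ ω, ⟪φ (X n ω), φ (X n ω)⟫ ∂P = ∫ ω, ‖φ (X 0 ω)‖ ^ 2 ∂P := by
    intro n
    simp only [real_inner_self_eq_norm_sq]
    exact integral_comp_of_identDistrib hident (φ := fun x => ‖φ x‖ ^ 2)
      (hφ.norm.pow 2) n
  have hexp : ∀ ω, ‖(N : ℝ)⁻¹ • ∑ n ∈ Finset.range N, φ (X n ω)‖ ^ 2 =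
      (N : ℝ)⁻¹ ^ 2 * ∑ n ∈ Finset.range N, ∑ k ∈ Finset.range N,
        ⟪φ (X n ω), φ (X k ω)⟫ := by
    intro ω
    rw [norm_smul, mul_pow, Real.norm_eq_abs, sq_abs, ← real_inner_self_eq_norm_sq, sum_inner]
    simp only [inner_sum]
  simp only [hexp]
  refine ⟨(integrable_finsetSum _ fun n _ => integrable_finsetSum _ fun k _ =>
    hcross n k).const_mul _, le_of_eq ?_⟩
  rw [integral_const_mul, integral_finsetSum _ fun n _ => integrable_finsetSum _ fun k _ =>
    hcross n k]
  have hrow : ∀ n ∈ Finset.range N, ∫ ω, ∑ k ∈ Finset.range N, ⟪φ (X n ω), φ (X k ω)⟫ ∂P =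
      ∫ ω, ‖φ (X 0 ω)‖ ^ 2 ∂P := by
    intro n hn
    rw [integral_finsetSum _ fun k _ => hcross n k, Finset.sum_eq_single_of_mem n hn, hdiag]
    exact fun k _ hk => hoff n k hk.symm
  rw [Finset.sum_congr rfl hrow, Finset.sum_const, Finset.card_range, nsmul_eq_mul]
  rcases Nat.eq_zero_or_pos N with rfl | hN
  · simp
  · field_simp

/-- Chebyshev's inequality, with the variance bounded by the second moment. -/
theorem prob_mean_ge_le [CompleteSpace H] (hindep : iIndepFun X P)
    (hident : ∀ n, IdentDistrib (X n) (X 0) P P) {φ : E → H} (hφ : StronglyMeasurable φ)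
    (hL : MemLp (fun ω => φ (X 0 ω)) 2 P) {N : ℕ} (hN : 1 ≤ N) {V M δ : ℝ}
    (hV : ∫ ω, ‖φ (X 0 ω)‖ ^ 2 ∂P ≤ V) (hM : 0 < M) (hVM : V ≤ δ * M ^ 2) :
    P.real {ω | M / √N ≤ ‖(N : ℝ)⁻¹ • ∑ n ∈ Finset.range N, φ (X n ω) -
      ∫ ω', φ (X 0 ω') ∂P‖} ≤ δ := by
  set c := ∫ ω', φ (X 0 ω') ∂P with hc
  have hN0 : (0 : ℝ) < N := by exact_mod_cast hN
  have hint : Integrable (fun ω => φ (X 0 ω)) P := hL.integrable one_le_two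
  have hL' : MemLp (fun ω => φ (X 0 ω) - c) 2 P := hL.sub (memLp_const c)
  have h0 : ∫ ω, (φ (X 0 ω) - c) ∂P = 0 := by
    rw [integral_sub hint (integrable_const c)]
    simp [hc]
  have hvar : ∫ ω, ‖φ (X 0 ω) - c‖ ^ 2 ∂P ≤ V := by
    refine le_trans ?_ hV
    have h1 : ∀ ω, ‖φ (X 0 ω) - c‖ ^ 2 = ‖φ (X 0 ω)‖ ^ 2 - 2 * ⟪c, φ (X 0 ω)⟫ + ‖c‖ ^ 2 := by
      intro ω
      rw [norm_sub_sq_real, real_inner_comm]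
    have hI := hL.integrable_norm_pow two_ne_zero
    have hJ : Integrable (fun ω => 2 * ⟪c, φ (X 0 ω)⟫) P := (hint.const_inner c).const_mul 2
    simp only [h1]
    have hadd := integral_add (hI.sub hJ) (integrable_const (‖c‖ ^ 2))
    simp only [Pi.sub_apply] at hadd
    rw [hadd, integral_sub hI hJ, integral_const_mul,
      integral_inner hint, ← hc, real_inner_self_eq_norm_sq]
    simp only [integral_const, probReal_univ, one_smul]
    nlinarith [sq_nonneg ‖c‖]
  obtain ⟨hI, hle⟩ := integral_norm_mean_sq_le hindep hident (hφ.sub stronglyMeasurable_const)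
    hL' h0 N
  have hmean : ∀ ω, (N : ℝ)⁻¹ • ∑ n ∈ Finset.range N, (φ (X n ω) - c) =
      (N : ℝ)⁻¹ • ∑ n ∈ Finset.range N, φ (X n ω) - c := by
    intro ω
    rw [Finset.sum_sub_distrib, smul_sub]
    simp only [Finset.sum_const, Finset.card_range, ← Nat.cast_smul_eq_nsmul ℝ, smul_smul]
    rw [inv_mul_cancel₀ hN0.ne', one_smul]
  simp only [Pi.sub_apply, ← hc, hmean] at hI hle
  have hmark := mul_meas_ge_le_integral_of_nonneg
    (Eventually.of_forall fun ω => sq_nonneg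
      ‖(N : ℝ)⁻¹ • ∑ n ∈ Finset.range N, φ (X n ω) - c‖) hI (M ^ 2 / N)
  have hset : {ω | M / √N ≤ ‖(N : ℝ)⁻¹ • ∑ n ∈ Finset.range N, φ (X n ω) - c‖} =
      {ω | M ^ 2 / N ≤ ‖(N : ℝ)⁻¹ • ∑ n ∈ Finset.range N, φ (X n ω) - c‖ ^ 2} := by
    ext ω
    simp only [Set.mem_ofPred_eq]
    rw [← sq_le_sq₀ (by positivity) (norm_nonneg _), div_pow, Real.sq_sqrt hN0.le]
  rw [hset]
  have h2 : M ^ 2 / N * P.real {ω | M ^ 2 / N ≤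
      ‖(N : ℝ)⁻¹ • ∑ n ∈ Finset.range N, φ (X n ω) - c‖ ^ 2} ≤ M ^ 2 / N * δ := by
    refine hmark.trans (hle.trans ?_)
    rw [div_mul_eq_mul_div, inv_mul_eq_div]
    gcongr
    linarith
  exact le_of_mul_le_mul_left h2 (by positivity)

/-- Markov's inequality without any gain from averaging, for the part that has only a first moment.
The mean and its centering each cost ∫ ‖φ‖, hence the factor 2. -/
theorem prob_mean_ge_le_of_integral_norm (hident : ∀ n, IdentDistrib (X n) (X 0) P P)
    {φ : E → H} (hφ : StronglyMeasurable φ) (hL : Integrable (fun ω => φ (X 0 ω)) P)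
    {N : ℕ} (hN : 1 ≤ N) {τ δ : ℝ} (hτ : 0 < τ)
    (h : 2 * ∫ ω, ‖φ (X 0 ω)‖ ∂P ≤ δ * τ) :
    P.real {ω | τ ≤ ‖(N : ℝ)⁻¹ • ∑ n ∈ Finset.range N, φ (X n ω) -
      ∫ ω', φ (X 0 ω') ∂P‖} ≤ δ := by
  set c := ∫ ω', φ (X 0 ω') ∂P with hc
  have hN0 : (0 : ℝ) < N := by exact_mod_cast hN
  have hLn : ∀ n, Integrable (fun ω => φ (X n ω)) P := fun n =>
    memLp_one_iff_integrable.1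
      (memLp_comp_of_identDistrib hident hφ (memLp_one_iff_integrable.2 hL) n)
  set f : Ω → ℝ := fun ω => (N : ℝ)⁻¹ * ∑ n ∈ Finset.range N, ‖φ (X n ω)‖ + ‖c‖ with hf
  have hS : Integrable (fun ω => (N : ℝ)⁻¹ * ∑ n ∈ Finset.range N, ‖φ (X n ω)‖) P :=
    (integrable_finsetSum _ fun n _ => (hLn n).norm).const_mul _
  have hfint : ∫ ω, f ω ∂P ≤ 2 * ∫ ω, ‖φ (X 0 ω)‖ ∂P := by
    rw [hf, integral_add hS (integrable_const _), integral_const_mul,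
      integral_finsetSum _ fun n _ => (hLn n).norm,
      Finset.sum_congr rfl fun n _ => integral_comp_of_identDistrib hident hφ.norm n]
    have : ‖c‖ ≤ ∫ ω, ‖φ (X 0 ω)‖ ∂P := norm_integral_le_integral_norm _
    simp only [Finset.sum_const, Finset.card_range, nsmul_eq_mul, integral_const, probReal_univ,
      one_smul]
    rw [inv_mul_cancel_left₀ hN0.ne']
    linarith
  have hmark := mul_meas_ge_le_integral_of_nonneg (μ := P) (f := f)
    (Eventually.of_forall fun ω => by simp only [hf, Pi.zero_apply]; positivity)
    (hS.add (integrable_const _)) τ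
  have hsub : {ω | τ ≤ ‖(N : ℝ)⁻¹ • ∑ n ∈ Finset.range N, φ (X n ω) - c‖} ⊆
      {ω | τ ≤ f ω} := by
    intro ω hω
    refine le_trans hω ((norm_sub_le _ _).trans ?_)
    simp only [hf]
    rw [norm_smul, Real.norm_eq_abs, abs_of_pos (inv_pos.2 hN0)]
    gcongr
    exact norm_sum_le _ _
  refine (measureReal_mono hsub).trans (le_of_mul_le_mul_left ?_ hτ)
  calc τ * P.real {ω | τ ≤ f ω} ≤ _ := hmark
    _ ≤ _ := hfint
    _ ≤ τ * δ := by linarith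

end LawOfLargeNumbers

/-! ### Fluctuations of the empirical covariance -/

theorem empiricalCov_eq {N : ℕ} (hN : 1 ≤ N) (Y : ℕ → LTwoSquare) :
    empiricalCov N Y = (N : ℝ)⁻¹ • ∑ n ∈ Finset.range N, tensor (Y n) (Y n) -
      tensor ((N : ℝ)⁻¹ • ∑ n ∈ Finset.range N, Y n)
        ((N : ℝ)⁻¹ • ∑ n ∈ Finset.range N, Y n) := by
  have hN0 : (N : ℝ) ≠ 0 := by positivity
  set m := (N : ℝ)⁻¹ • ∑ n ∈ Finset.range N, Y n with hm
  have h1 : ∀ n, tensor (Y n - m) (Y n - m) =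
      tensor (Y n) (Y n) - tensorL m (Y n) - tensorL.flip m (Y n) + tensor m m := by
    intro n
    simp only [← tensorL_apply, map_sub, ContinuousLinearMap.flip_apply,
      _root_.sub_apply]
    abel
  have h2 : (N : ℝ)⁻¹ • tensorL m (∑ n ∈ Finset.range N, Y n) = tensor m m := by
    rw [← map_smul, ← hm, tensorL_apply]
  have h3 : (N : ℝ)⁻¹ • tensorL.flip m (∑ n ∈ Finset.range N, Y n) = tensor m m := by
    rw [← map_smul, ← hm, ContinuousLinearMap.flip_apply, tensorL_apply]
  rw [empiricalCov, ← hm]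
  simp only [h1]
  rw [Finset.sum_add_distrib, Finset.sum_sub_distrib, Finset.sum_sub_distrib, ← map_sum,
    ← map_sum, Finset.sum_const, Finset.card_range, ← Nat.cast_smul_eq_nsmul ℝ, smul_add,
    smul_sub, smul_sub, h2, h3, inv_smul_smul₀ hN0]
  abel

/-- Lets the uncentered measurements be replaced by centered functions of the surfaces, which agree
with them up to a constant. -/
theorem empiricalCov_add_const {N : ℕ} (hN : 1 ≤ N) (Y : ℕ → LTwoSquare) (a : LTwoSquare) :
    empiricalCov N (fun n => Y n + a) = empiricalCov N Y := by
  have hN0 : (N : ℝ) ≠ 0 := by positivity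
  have h : ∀ n, Y n + a - (N : ℝ)⁻¹ • ∑ m ∈ Finset.range N, (Y m + a) =
      Y n - (N : ℝ)⁻¹ • ∑ m ∈ Finset.range N, Y m := by
    intro n
    rw [Finset.sum_add_distrib, Finset.sum_const, Finset.card_range, ← Nat.cast_smul_eq_nsmul ℝ,
      smul_add, smul_smul, inv_mul_cancel₀ hN0, one_smul]
    abel
  simp only [empiricalCov, h]

section Fluctuation

variable {Ω E : Type*} [MeasurableSpace Ω] {P : Measure Ω} [IsProbabilityMeasure P]
  [MeasurableSpace E] {X : ℕ → Ω → E}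

/-- If `F` is the sum of `G`, which has a fourth moment, and of a remainder with a small second
moment, then the empirical covariance of `F` is concentrated up to that second moment. -/
theorem prob_empiricalCov_sub_le (hindep : iIndepFun X P)
    (hident : ∀ n, IdentDistrib (X n) (X 0) P P) {F G : E → LTwoSquare}
    (hF : StronglyMeasurable F) (hG : StronglyMeasurable G)
    (hF0 : ∫ ω, F (X 0 ω) ∂P = 0) (hG4 : Integrable (fun ω => ‖G (X 0 ω)‖ ^ 4) P)
    (hFL : MemLp (fun ω => F (X 0 ω)) 2 P) (hGL : MemLp (fun ω => G (X 0 ω)) 2 P)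
    {V W β δ M₁ M₂ τ : ℝ} (hV : ∫ ω, ‖G (X 0 ω)‖ ^ 4 ∂P ≤ V)
    (hW : ∫ ω, ‖F (X 0 ω)‖ ^ 2 ∂P ≤ W) (hβ : ∫ ω, ‖F (X 0 ω) - G (X 0 ω)‖ ^ 2 ∂P ≤ β)
    (hM₁ : 0 < M₁) (hM₂ : 0 < M₂) (hτ : 0 < τ) (hVM : 16 * V ≤ δ * M₁ ^ 2)
    (hWM : W ≤ δ * M₂ ^ 2) (hβτ : 8 * β ≤ δ * τ) {N : ℕ} (hN : 1 ≤ N) :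
    P.real {ω | τ + (M₁ + M₂ ^ 2) / √N < ‖empiricalCov N (fun n => F (X n ω)) -
      ∫ ω', tensor (F (X 0 ω')) (F (X 0 ω')) ∂P‖} ≤ 3 * δ := by
  have hN1 : (1 : ℝ) ≤ N := by exact_mod_cast hN
  -- Truncation: on `S` the norm of `F` is at most `2 * ‖G x‖`, off `S` at most `2 * ‖F x - G x‖`.
  -- So `φ₁` has a second moment and `φ₂` a small first moment.
  set S : Set E := {x | ‖F x - G x‖ ≤ ‖G x‖} with hS
  have hSm : MeasurableSet S := measurableSet_le (hF.sub hG).norm.measurable hG.norm.measurable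
  have hT : StronglyMeasurable fun x => tensor (F x) (F x) :=
    continuous_tensor_self.comp_stronglyMeasurable hF
  set φ₁ : E → HSKernel := S.indicator fun x => tensor (F x) (F x) with hφ₁
  set φ₂ : E → HSKernel := Sᶜ.indicator fun x => tensor (F x) (F x) with hφ₂
  have hφ₁m : StronglyMeasurable φ₁ := hT.indicator hSm
  have hφ₂m : StronglyMeasurable φ₂ := hT.indicator hSm.compl
  have hsum : ∀ x, tensor (F x) (F x) = φ₁ x + φ₂ x := fun x =>
    (Set.indicator_self_add_compl_apply S (fun x => tensor (F x) (F x)) x).symm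
  have hb₁ : ∀ x, ‖φ₁ x‖ ^ 2 ≤ 16 * ‖G x‖ ^ 4 := by
    intro x
    by_cases hx : x ∈ S
    · have h1 : ‖F x‖ ≤ 2 * ‖G x‖ := by
        have h2 := norm_add_le (F x - G x) (G x)
        have h3 : ‖F x - G x‖ ≤ ‖G x‖ := hx
        rw [sub_add_cancel] at h2
        linarith
      rw [hφ₁, Set.indicator_of_mem hx, norm_tensor]
      calc (‖F x‖ * ‖F x‖) ^ 2 = ‖F x‖ ^ 4 := by ring
        _ ≤ (2 * ‖G x‖) ^ 4 := by gcongr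
        _ = 16 * ‖G x‖ ^ 4 := by ring
    · rw [hφ₁, Set.indicator_of_notMem hx]
      rw [norm_zero, zero_pow two_ne_zero]
      positivity
  have hb₂ : ∀ x, ‖φ₂ x‖ ≤ 4 * ‖F x - G x‖ ^ 2 := by
    intro x
    by_cases hx : x ∈ S
    · rw [hφ₂, Set.indicator_of_notMem (by simpa using hx)]
      rw [norm_zero]
      positivity
    · have h1 : ‖F x‖ ≤ 2 * ‖F x - G x‖ := by
        have h2 := norm_add_le (F x - G x) (G x)
        have h3 : ‖G x‖ < ‖F x - G x‖ := not_le.1 hx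
        rw [sub_add_cancel] at h2
        linarith
      rw [hφ₂, Set.indicator_of_mem (by simpa using hx), norm_tensor]
      calc ‖F x‖ * ‖F x‖ = ‖F x‖ ^ 2 := by ring
        _ ≤ (2 * ‖F x - G x‖) ^ 2 := by gcongr
        _ = 4 * ‖F x - G x‖ ^ 2 := by ring
  have hX0 := (hident 0).aemeasurable_fst
  have hm₁ : AEStronglyMeasurable (fun ω => φ₁ (X 0 ω)) P :=
    hφ₁m.aestronglyMeasurable.comp_aemeasurable hX0
  have hm₂ : AEStronglyMeasurable (fun ω => φ₂ (X 0 ω)) P :=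
    hφ₂m.aestronglyMeasurable.comp_aemeasurable hX0
  have hL₁ : MemLp (fun ω => φ₁ (X 0 ω)) 2 P := by
    rw [memLp_two_iff_integrable_sq_norm hm₁]
    refine (hG4.const_mul 16).mono' (hm₁.norm.pow 2) (Eventually.of_forall fun ω => ?_)
    rw [Real.norm_of_nonneg (sq_nonneg _)]
    exact hb₁ _
  have hD : Integrable (fun ω => ‖F (X 0 ω) - G (X 0 ω)‖ ^ 2) P :=
    (hFL.sub hGL).integrable_norm_pow two_ne_zero
  have hL₂ : Integrable (fun ω => φ₂ (X 0 ω)) P :=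
    (hD.const_mul 4).mono' hm₂ (Eventually.of_forall fun ω => hb₂ _)
  have hΓ : ∫ ω, tensor (F (X 0 ω)) (F (X 0 ω)) ∂P =
      ∫ ω, φ₁ (X 0 ω) ∂P + ∫ ω, φ₂ (X 0 ω) ∂P := by
    rw [← integral_add (hL₁.integrable one_le_two) hL₂]
    exact integral_congr_ae (Eventually.of_forall fun ω => hsum _)
  have hV₁ : ∫ ω, ‖φ₁ (X 0 ω)‖ ^ 2 ∂P ≤ 16 * V := by
    calc ∫ ω, ‖φ₁ (X 0 ω)‖ ^ 2 ∂P ≤ ∫ ω, 16 * ‖G (X 0 ω)‖ ^ 4 ∂P :=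
          integral_mono (hL₁.integrable_norm_pow two_ne_zero) (hG4.const_mul 16)
            fun ω => hb₁ _
      _ ≤ 16 * V := by rw [integral_const_mul]; linarith
  have hV₂ : 2 * ∫ ω, ‖φ₂ (X 0 ω)‖ ∂P ≤ δ * τ := by
    have h1 : ∫ ω, ‖φ₂ (X 0 ω)‖ ∂P ≤ ∫ ω, 4 * ‖F (X 0 ω) - G (X 0 ω)‖ ^ 2 ∂P :=
      integral_mono hL₂.norm (hD.const_mul 4) fun ω => hb₂ _
    rw [integral_const_mul] at h1
    linarith
  have hp₁ := prob_mean_ge_le hindep hident hφ₁m hL₁ hN hV₁ hM₁ hVM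
  have hp₂ := prob_mean_ge_le_of_integral_norm hident hφ₂m hL₂ hN hτ hV₂
  have hp₃ := prob_mean_ge_le hindep hident hF hFL hN hW hM₂ hWM
  rw [hF0] at hp₃
  simp only [sub_zero] at hp₃
  refine (measureReal_mono (fun ω hω => ?_) : _ ≤ P.real (_ ∪ (_ ∪ _))).trans
    ((measureReal_union_le _ _).trans
      ((add_le_add hp₁ ((measureReal_union_le _ _).trans (add_le_add hp₂ hp₃))).trans
        (by linarith)))
  by_contra hcon
  simp only [Set.mem_union, Set.mem_ofPred_eq, not_or, not_le] at hcon hω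
  obtain ⟨h1, h2, h3⟩ := hcon
  refine absurd hω (not_lt.2 ?_)
  have hsqrt : 0 < √(N : ℝ) := Real.sqrt_pos.2 (by linarith)
  have hmean : ‖(N : ℝ)⁻¹ • ∑ n ∈ Finset.range N, F (X n ω)‖ ^ 2 ≤ M₂ ^ 2 / √N := by
    calc ‖(N : ℝ)⁻¹ • ∑ n ∈ Finset.range N, F (X n ω)‖ ^ 2 ≤ (M₂ / √N) ^ 2 := by gcongr
      _ = M₂ ^ 2 / N := by rw [div_pow, Real.sq_sqrt (by linarith)]
      -- The product of the sample means is of order 1/N, which is more than needed; √N ≤ N since N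
      -- ≥ 1.
      _ ≤ M₂ ^ 2 / √N := by
        gcongr
        exact Real.sqrt_le_iff.2 ⟨by linarith, by nlinarith⟩
  have hdec : empiricalCov N (fun n => F (X n ω)) -
      ∫ ω', tensor (F (X 0 ω')) (F (X 0 ω')) ∂P =
      ((N : ℝ)⁻¹ • ∑ n ∈ Finset.range N, φ₁ (X n ω) - ∫ ω', φ₁ (X 0 ω') ∂P) +
      ((N : ℝ)⁻¹ • ∑ n ∈ Finset.range N, φ₂ (X n ω) - ∫ ω', φ₂ (X 0 ω') ∂P) -
      tensor ((N : ℝ)⁻¹ • ∑ n ∈ Finset.range N, F (X n ω))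
        ((N : ℝ)⁻¹ • ∑ n ∈ Finset.range N, F (X n ω)) := by
    rw [empiricalCov_eq hN, hΓ]
    simp only [hsum (X _ ω)]
    rw [Finset.sum_add_distrib, smul_add]
    abel
  rw [hdec]
  refine (norm_sub_le _ _).trans ((add_le_add_left (norm_add_le _ _) _).trans ?_)
  rw [norm_tensor, ← sq, add_div]
  linarith

end Fluctuation

/-! ### Indicators and averages -/

/-- The indicator function of a measurable subset of the square. -/
noncomputable def ind {B : Set Square} (hB : MeasurableSet B) : LTwoSquare :=
  indicatorConstLp 2 hB (measure_ne_top volume _) (1 : ℝ)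

/-- The normalized indicator function, which represents the average over a set. -/
noncomputable def avgVec {B : Set Square} (hB : MeasurableSet B) : LTwoSquare :=
  ((volume : Measure Square).real B)⁻¹ • ind hB

theorem inner_ind {B : Set Square} (hB : MeasurableSet B) (x : LTwoSquare) :
    ⟪ind hB, x⟫ = ∫ p in B, x p :=
  L2.inner_indicatorConstLp_one hB _ x

theorem inner_ind_ind {B B' : Set Square} (hB : MeasurableSet B) (hB' : MeasurableSet B') :
    ⟪ind hB, ind hB'⟫ = (volume : Measure Square).real (B ∩ B') :=
  L2.real_inner_indicatorConstLp_one_indicatorConstLp_one hB hB'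

theorem inner_avgVec {B : Set Square} (hB : MeasurableSet B) (x : LTwoSquare) :
    ⟪avgVec hB, x⟫ = ((volume : Measure Square).real B)⁻¹ * ∫ p in B, x p := by
  rw [avgVec, real_inner_smul_left, inner_ind]

theorem ind_coeFn {B : Set Square} (hB : MeasurableSet B) :
    (ind hB : Square → ℝ) =ᵐ[volume] B.indicator fun _ => 1 :=
  indicatorConstLp_coeFn

theorem tensor_ind {B B' : Set Square} (hB : MeasurableSet B) (hB' : MeasurableSet B') :
    tensor (ind hB) (ind hB') =
      indicatorConstLp 2 (hB.prod hB') (measure_ne_top volume _) (1 : ℝ) := by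
  refine Lp.ext ?_
  filter_upwards [tensor_coeFn (ind hB) (ind hB'), ae_fst (ind_coeFn hB), ae_snd (ind_coeFn hB'),
    indicatorConstLp_coeFn (p := 2) (hs := hB.prod hB')
      (hμs := measure_ne_top (volume : Measure (Square × Square)) _) (c := (1 : ℝ))]
    with z h1 h2 h3 h4
  rw [h1, h2, h3, h4]
  by_cases hz1 : z.1 ∈ B <;> by_cases hz2 : z.2 ∈ B' <;> simp [Set.indicator, hz1, hz2]

theorem norm_sq_sum_smul_ind {ι : Type*} [Fintype ι] {B : ι → Set Square}
    (hB : ∀ i, MeasurableSet (B i)) (hd : Pairwise fun i j => Disjoint (B i) (B j)) (a : ι → ℝ) :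
    ‖∑ i, a i • ind (hB i)‖ ^ 2 = ∑ i, (volume : Measure Square).real (B i) * a i ^ 2 := by
  rw [← real_inner_self_eq_norm_sq, sum_inner]
  refine Finset.sum_congr rfl fun i _ => ?_
  rw [inner_sum, Finset.sum_eq_single i]
  · rw [real_inner_smul_left, real_inner_smul_right, inner_ind_ind, Set.inter_self]
    ring
  · intro j _ hj
    rw [real_inner_smul_left, real_inner_smul_right, inner_ind_ind, (hd hj.symm).inter_eq]
    simp
  · exact fun h => absurd (Finset.mem_univ i) h

/-- The step function `y` of the averages is the orthogonal projection of `x` onto the span of the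
indicators, so its norm is at most that of `x`. On null sets the average vector is 0 because 0⁻¹ =
0. -/
theorem sum_measure_mul_inner_avgVec_sq_le {ι : Type*} [Fintype ι] {B : ι → Set Square}
    (hB : ∀ i, MeasurableSet (B i)) (hd : Pairwise fun i j => Disjoint (B i) (B j))
    (x : LTwoSquare) :
    ∑ i, (volume : Measure Square).real (B i) * ⟪avgVec (hB i), x⟫ ^ 2 ≤ ‖x‖ ^ 2 := by
  set y : LTwoSquare := ∑ i, ⟪avgVec (hB i), x⟫ • ind (hB i) with hy
  have h1 : ‖y‖ ^ 2 = ∑ i, (volume : Measure Square).real (B i) * ⟪avgVec (hB i), x⟫ ^ 2 :=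
    norm_sq_sum_smul_ind hB hd _
  have h2 : ⟪y, x⟫ = ‖y‖ ^ 2 := by
    rw [h1, hy, sum_inner]
    refine Finset.sum_congr rfl fun i _ => ?_
    rw [real_inner_smul_left]
    by_cases h0 : (volume : Measure Square).real (B i) = 0
    · rw [avgVec, h0]
      simp
    · have : ⟪ind (hB i), x⟫ = (volume : Measure Square).real (B i) * ⟪avgVec (hB i), x⟫ := by
        rw [avgVec, real_inner_smul_left, mul_inv_cancel_left₀ h0]
      rw [this]
      ring
  rw [← h1]
  have h3 := real_inner_le_norm y x
  rw [h2] at h3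
  nlinarith [norm_nonneg y, norm_nonneg x, sq_nonneg (‖x‖ - ‖y‖)]

/-- The pairing is the average of the kernel over `B ×ˢ B'`, so it inherits any uniform bound on the
oscillation there. -/
theorem abs_inner_tensor_avgVec_sub_le {C : HSKernel} {c : Square × Square → ℝ}
    (hker : C =ᵐ[volume] c) {B B' : Set Square} (hB : MeasurableSet B) (hB' : MeasurableSet B')
    (hB0 : (volume : Measure Square).real B ≠ 0) (hB0' : (volume : Measure Square).real B' ≠ 0)
    {v τ : ℝ} (h : ∀ z ∈ B ×ˢ B', |c z - v| ≤ τ) :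
    |⟪C, tensor (avgVec hB) (avgVec hB')⟫ - v| ≤ τ := by
  set b := (volume : Measure Square).real B with hb
  set b' := (volume : Measure Square).real B' with hb'
  have hvol : (volume : Measure (Square × Square)).real (B ×ˢ B') = b * b' :=
    measureReal_prod_prod B B'
  have h1 : ⟪C, tensor (avgVec hB) (avgVec hB')⟫ = b⁻¹ * b'⁻¹ * ∫ z in B ×ˢ B', C z := by
    rw [avgVec, avgVec, tensor_smul_left, tensor_smul_right, tensor_ind, real_inner_smul_right,
      real_inner_smul_right, real_inner_comm, L2.inner_indicatorConstLp_one, mul_assoc]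
  have hC : IntegrableOn (fun z => C z) (B ×ˢ B') volume :=
    ((Lp.memLp C).integrable one_le_two).integrableOn
  have h2 : ∫ z in B ×ˢ B', (C z - v) = (∫ z in B ×ˢ B', C z) - b * b' * v := by
    rw [integral_sub hC (integrableOn_const (measure_ne_top _ _)), setIntegral_const, hvol,
      smul_eq_mul]
  have h3 : ‖∫ z in B ×ˢ B', (C z - v)‖ ≤ τ * (b * b') := by
    rw [← hvol]
    refine norm_setIntegral_le_of_norm_le_const_ae' (measure_lt_top _ _) ?_
    filter_upwards [hker] with z hz hzB
    rw [hz]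
    exact h z hzB
  have hbpos : 0 < b * b' :=
    mul_pos (measureReal_nonneg.lt_of_ne' hB0) (measureReal_nonneg.lt_of_ne' hB0')
  have h4 : ⟪C, tensor (avgVec hB) (avgVec hB')⟫ - v =
      (b * b')⁻¹ * ∫ z in B ×ˢ B', (C z - v) := by
    rw [h1, h2, mul_inv, mul_sub]
    field_simp
  rw [h4, abs_mul, abs_of_pos (inv_pos.2 hbpos), inv_mul_le_iff₀ hbpos, mul_comm (b * b')]
  exact h3

/-! ### Linear functionals of a random surface -/

section Pairing

variable {Ω : Type*} [MeasurableSpace Ω] {P : Measure Ω} {Z : Ω → LTwoSquare}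

/-- The linear functional `⟪u, Z⟫` of a random surface with finite second moment, as an element
of `L²`. -/
noncomputable def pairing (hZ : MemLp Z 2 P) (u : LTwoSquare) : Lp ℝ 2 P :=
  (hZ.const_inner (𝕜 := ℝ) u).toLp _

theorem pairing_coeFn (hZ : MemLp Z 2 P) (u : LTwoSquare) :
    (pairing hZ u : Ω → ℝ) =ᵐ[P] fun ω => ⟪u, Z ω⟫ :=
  MemLp.coeFn_toLp _

/-- The link from the kernel to probability: the L² geometry of linear functionals of `Z` is read
off the second moment operator. -/
theorem inner_pairing (hZ : MemLp Z 2 P) (u v : LTwoSquare) :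
    ⟪pairing hZ u, pairing hZ v⟫ = ⟪∫ ω, tensor (Z ω) (Z ω) ∂P, tensor u v⟫ := by
  have hint : Integrable (fun ω => tensor (Z ω) (Z ω)) P := by
    refine (hZ.integrable_norm_pow two_ne_zero).mono'
      (continuous_tensor_self.comp_aestronglyMeasurable hZ.1)
      (Eventually.of_forall fun ω => ?_)
    rw [norm_tensor, sq]
  rw [real_inner_comm (tensor u v), ← integral_inner hint, L2.inner_def]
  refine integral_congr_ae ?_
  filter_upwards [pairing_coeFn hZ u, pairing_coeFn hZ v] with ω h1 h2
  rw [h1, h2, inner_tensor]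
  simp [mul_comm]

theorem norm_pairing_sub_sq (hZ : MemLp Z 2 P) (u v : LTwoSquare) :
    ‖pairing hZ u - pairing hZ v‖ ^ 2 =
      ⟪∫ ω, tensor (Z ω) (Z ω) ∂P, tensor u u⟫ - ⟪∫ ω, tensor (Z ω) (Z ω) ∂P, tensor u v⟫ -
      ⟪∫ ω, tensor (Z ω) (Z ω) ∂P, tensor v u⟫ + ⟪∫ ω, tensor (Z ω) (Z ω) ∂P, tensor v v⟫ := by
  rw [← inner_pairing hZ, ← inner_pairing hZ, ← inner_pairing hZ, ← inner_pairing hZ,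
    ← real_inner_self_eq_norm_sq, inner_sub_left, inner_sub_right, inner_sub_right]
  ring

theorem integral_pairing [IsProbabilityMeasure P] (hZ : MemLp Z 2 P) (hZ0 : ∫ ω, Z ω ∂P = 0)
    (u : LTwoSquare) : ∫ ω, pairing hZ u ω ∂P = 0 := by
  rw [integral_congr_ae (pairing_coeFn hZ u), integral_inner (hZ.integrable one_le_two), hZ0,
    inner_zero_right]

theorem integral_eq_zero_of_tendsto [IsProbabilityMeasure P] {z : ℕ → Lp ℝ 2 P} {z' : Lp ℝ 2 P}
    (hz : Tendsto z atTop (𝓝 z')) (h0 : ∀ k, ∫ ω, z k ω ∂P = 0) : ∫ ω, z' ω ∂P = 0 := by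
  have h1 : ∀ y : Lp ℝ 2 P,
      ⟪indicatorConstLp 2 MeasurableSet.univ (measure_ne_top P _) (1 : ℝ), y⟫ =
        ∫ ω, y ω ∂P := by
    intro y
    rw [L2.inner_indicatorConstLp_one, setIntegral_univ]
  have h2 := (tendsto_const_nhds (x := indicatorConstLp 2 MeasurableSet.univ
    (measure_ne_top P Set.univ) (1 : ℝ))).inner hz (𝕜 := ℝ)
  simp only [h1, h0] at h2
  exact (tendsto_nhds_unique h2 tendsto_const_nhds)

theorem exists_tendsto_of_norm_sub_sq_le {V : Type*} [NormedAddCommGroup V] [CompleteSpace V]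
    {z : ℕ → V} {δ : ℕ → ℝ} (hδ : Tendsto δ atTop (𝓝 0))
    (h : ∀ k l, k ≤ l → ‖z l - z k‖ ^ 2 ≤ δ k) :
    ∃ z', Tendsto z atTop (𝓝 z') ∧ ∀ k, ‖z' - z k‖ ^ 2 ≤ δ k := by
  have hc : CauchySeq z := by
    refine cauchySeq_of_le_tendsto_0' (fun k => √(δ k)) (fun k l hkl => ?_) ?_
    · rw [dist_eq_norm, norm_sub_rev]
      exact Real.le_sqrt_of_sq_le (h k l hkl)
    · simpa using hδ.sqrt
  obtain ⟨z', hz'⟩ := cauchySeq_tendsto_of_complete hc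
  refine ⟨z', hz', fun k => ?_⟩
  refine le_of_tendsto ((hz'.sub_const (z k)).norm.pow 2) ?_
  filter_upwards [eventually_ge_atTop k] with l hl using h k l hl

/-- If linear functionals of `Z` converge in `L²`, and those of `Z + μ` converge almost surely,
then the limits differ by a constant. -/
theorem exists_eq_sub_const_of_tendsto [IsProbabilityMeasure P] (hZ : MemLp Z 2 P)
    {μ : LTwoSquare} {b : ℕ → LTwoSquare} {z : Lp ℝ 2 P} {f : Ω → ℝ}
    (hz : Tendsto (fun k => pairing hZ (b k)) atTop (𝓝 z))
    (hf : ∀ᵐ ω ∂P, Tendsto (fun k => ⟪b k, Z ω + μ⟫) atTop (𝓝 (f ω))) :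
    ∃ m : ℝ, ∀ᵐ ω ∂P, z ω = f ω - m := by
  obtain ⟨ns, hns, hlim⟩ := (tendstoInMeasure_of_tendsto_Lp hz).exists_seq_tendsto_ae
  have hall : ∀ᵐ ω ∂P, ∀ k, pairing hZ (b k) ω = ⟪b k, Z ω⟫ :=
    ae_all_iff.2 fun k => pairing_coeFn hZ (b k)
  have hconst : ∀ᵐ ω ∂P, Tendsto (fun k => ⟪b (ns k), μ⟫) atTop (𝓝 (f ω - z ω)) := by
    filter_upwards [hlim, hall, hf] with ω h1 h2 h3
    have h4 := (h3.comp hns.tendsto_atTop).sub h1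
    refine h4.congr fun k => ?_
    simp only [Function.comp_apply, h2, inner_add_right]
    ring
  -- The difference of the two limits is the limit of the deterministic sequence ⟪b (ns k), μ⟫. Its
  -- convergence is not known beforehand, but it follows from a single good `ω₀`.
  obtain ⟨ω₀, hω₀⟩ := hconst.exists
  refine ⟨f ω₀ - z ω₀, ?_⟩
  filter_upwards [hconst] with ω hω
  rw [tendsto_nhds_unique hω₀ hω]
  ring

end Pairing

/-! ### Geometry of the pixels -/

theorem cell_subset {K : ℕ} {i : Fin K} {t : unitInterval} (ht : t ∈ cell K i) :
    (i : ℝ) / K ≤ t ∧ (t : ℝ) ≤ ((i : ℝ) + 1) / K := by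
  refine ⟨ht.1, ?_⟩
  rcases ht.2 with h | h
  · exact h.le
  · have hK : ((i : ℝ) + 1) = K := by exact_mod_cast h
    have hK0 : (K : ℝ) ≠ 0 := by
      have := i.pos
      positivity
    rw [hK, div_self hK0]
    exact t.2.2

theorem disjoint_cell {K : ℕ} {i j : Fin K} (hij : i ≠ j) : Disjoint (cell K i) (cell K j) := by
  have hK : (0 : ℝ) < K := by exact_mod_cast i.pos
  have key : ∀ {i j : Fin K}, i < j → Disjoint (cell K i) (cell K j) := by
    intro i j hlt
    rw [Set.disjoint_left]
    intro t hi hj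
    have hlt' : (i : ℕ) + 1 ≤ j := hlt
    rcases hi.2 with h | h
    · have h1 : ((i : ℝ) + 1) / K ≤ (j : ℝ) / K := by
        gcongr
        exact_mod_cast hlt'
      linarith [hj.1]
    · have := j.2
      omega
  rcases lt_or_gt_of_ne hij with h | h
  · exact key h
  · exact (key h).symm

theorem disjoint_pixel {K₁ K₂ : ℕ} :
    Pairwise fun p q : Fin K₁ × Fin K₂ => Disjoint (pixel K₁ K₂ p.1 p.2) (pixel K₁ K₂ q.1 q.2) := by
  intro p q hpq
  rw [pixel, pixel, Set.disjoint_prod]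
  by_cases h : p.1 = q.1
  · exact Or.inr (disjoint_cell fun h' => hpq (Prod.ext h h'))
  · exact Or.inl (disjoint_cell h)

theorem exists_mem_cell {K : ℕ} (hK : 1 ≤ K) (t : unitInterval) : ∃ i : Fin K, t ∈ cell K i := by
  have hK0 : (0 : ℝ) < K := by exact_mod_cast hK
  have hle : (⌊(t : ℝ) * K⌋₊ : ℝ) ≤ t * K := Nat.floor_le (mul_nonneg t.2.1 hK0.le)
  have hlt : (t : ℝ) * K < ⌊(t : ℝ) * K⌋₊ + 1 := Nat.lt_floor_add_one _
  by_cases h : ⌊(t : ℝ) * K⌋₊ < K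
  · refine ⟨⟨_, h⟩, ?_, Or.inl ?_⟩
    · rwa [div_le_iff₀ hK0]
    · rwa [lt_div_iff₀ hK0]
  · refine ⟨⟨K - 1, by omega⟩, ?_, Or.inr (Nat.sub_add_cancel hK)⟩
    rw [div_le_iff₀ hK0]
    have h1 : ((K - 1 : ℕ) : ℝ) ≤ ⌊(t : ℝ) * K⌋₊ := by
      exact_mod_cast (Nat.sub_le K 1).trans (not_lt.1 h)
    exact h1.trans hle

theorem exists_mem_pixel {K₁ K₂ : ℕ} (hK₁ : 1 ≤ K₁) (hK₂ : 1 ≤ K₂) (z : Square) :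
    ∃ p : Fin K₁ × Fin K₂, z ∈ pixel K₁ K₂ p.1 p.2 := by
  obtain ⟨i, hi⟩ := exists_mem_cell hK₁ z.1
  obtain ⟨j, hj⟩ := exists_mem_cell hK₂ z.2
  exact ⟨(i, j), hi, hj⟩

/-- The part of a cell that is within distance `r` of the point `t`. -/
def subcell (K : ℕ) (i : Fin K) (t : unitInterval) (r : ℝ) : Set unitInterval :=
  cell K i ∩ {u | |(u : ℝ) - t| ≤ r}

theorem measurableSet_subcell (K : ℕ) (i : Fin K) (t : unitInterval) (r : ℝ) :
    MeasurableSet (subcell K i t r) :=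
  (measurableSet_cell K i).inter
    (measurableSet_le (measurable_subtype_coe.sub_const _).abs measurable_const)

/-- The cell and the interval of radius r around t meet in length at least r, even if t is an
endpoint. Open intervals avoid the half-open ends of the cells. -/
theorem le_measureReal_subcell {K : ℕ} {i : Fin K} {t : unitInterval} {r : ℝ} (hr : 0 ≤ r)
    (hrK : r ≤ (K : ℝ)⁻¹) (ht : (i : ℝ) / K ≤ t) (ht' : (t : ℝ) ≤ ((i : ℝ) + 1) / K) :
    r ≤ (volume : Measure unitInterval).real (subcell K i t r) := by
  have hK : (0 : ℝ) < K := by exact_mod_cast i.pos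
  have hi1 : ((i : ℝ) + 1) / K ≤ 1 := by
    rw [div_le_one hK]
    exact_mod_cast i.2
  have hi0 : (0 : ℝ) ≤ (i : ℝ) / K := by positivity
  have hadd : ((i : ℝ) + 1) / K = (i : ℝ) / K + (K : ℝ)⁻¹ := by rw [add_div, one_div]
  let a : unitInterval := ⟨max ((i : ℝ) / K) (t - r), le_max_of_le_left hi0,
    max_le (by linarith) (by linarith [t.2.2])⟩
  let b : unitInterval := ⟨min (((i : ℝ) + 1) / K) (t + r),
    le_min (by positivity) (by linarith [t.2.1]), min_le_of_left_le hi1⟩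
  have hab : r ≤ (b : ℝ) - a := by
    have hb : (b : ℝ) = min (((i : ℝ) + 1) / K) (t + r) := rfl
    have ha : (a : ℝ) = max ((i : ℝ) / K) (t - r) := rfl
    rw [ha, hb]
    rcases min_cases (((i : ℝ) + 1) / K) ((t : ℝ) + r) with h1 | h1 <;>
      rcases max_cases ((i : ℝ) / K) ((t : ℝ) - r) with h2 | h2 <;> linarith
  have hsub : Set.Ioo a b ⊆ subcell K i t r := by
    intro u hu
    have h1 : max ((i : ℝ) / K) ((t : ℝ) - r) < u := hu.1
    have h2 : (u : ℝ) < min (((i : ℝ) + 1) / K) ((t : ℝ) + r) := hu.2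
    rw [max_lt_iff] at h1
    rw [lt_min_iff] at h2
    have h3 : |(u : ℝ) - t| ≤ r := abs_le.2 ⟨by linarith, by linarith⟩
    exact ⟨⟨h1.1.le, Or.inl h2.1⟩, h3⟩
  calc r ≤ (volume : Measure unitInterval).real (Set.Ioo a b) := by
        rw [measureReal_def, unitInterval.volume_Ioo, ENNReal.toReal_ofReal (by linarith)]
        exact hab
    _ ≤ _ := measureReal_mono hsub

theorem measureReal_cell {K : ℕ} (i : Fin K) :
    (volume : Measure unitInterval).real (cell K i) = (K : ℝ)⁻¹ := by
  have hK : (0 : ℝ) < K := by exact_mod_cast i.pos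
  have hi1 : ((i : ℝ) + 1) / K ≤ 1 := by
    rw [div_le_one hK]
    exact_mod_cast i.2
  have hadd : ((i : ℝ) + 1) / K = (i : ℝ) / K + (K : ℝ)⁻¹ := by rw [add_div, one_div]
  have hinv : (0 : ℝ) < (K : ℝ)⁻¹ := inv_pos.2 hK
  let a : unitInterval := ⟨(i : ℝ) / K, by positivity, by linarith⟩
  let b : unitInterval := ⟨((i : ℝ) + 1) / K, by positivity, hi1⟩
  refine le_antisymm ?_ ?_
  · calc (volume : Measure unitInterval).real (cell K i)
        ≤ (volume : Measure unitInterval).real (Set.Icc a b) :=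
          measureReal_mono fun u hu => ⟨(cell_subset hu).1, (cell_subset hu).2⟩
      _ = (K : ℝ)⁻¹ := by
        have : (b : ℝ) - a = (K : ℝ)⁻¹ := by
          change ((i : ℝ) + 1) / K - (i : ℝ) / K = _
          linarith
        rw [measureReal_def, unitInterval.volume_Icc, this, ENNReal.toReal_ofReal hinv.le]
  · exact (le_measureReal_subcell (t := a) hinv.le le_rfl le_rfl (by
      change (i : ℝ) / K ≤ _
      linarith)).trans (measureReal_mono Set.inter_subset_left)

theorem measureReal_pixel {K₁ K₂ : ℕ} (i : Fin K₁) (j : Fin K₂) :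
    (volume : Measure Square).real (pixel K₁ K₂ i j) = (K₁ : ℝ)⁻¹ * (K₂ : ℝ)⁻¹ := by
  rw [pixel, ← measureReal_cell i, ← measureReal_cell j]
  exact measureReal_prod_prod _ _

theorem sum_measureReal_pixel {K₁ K₂ : ℕ} (hK₁ : 1 ≤ K₁) (hK₂ : 1 ≤ K₂) :
    ∑ p : Fin K₁ × Fin K₂, (volume : Measure Square).real (pixel K₁ K₂ p.1 p.2) = 1 := by
  simp only [measureReal_pixel, Finset.sum_const, Finset.card_univ, Fintype.card_prod,
    Fintype.card_fin, nsmul_eq_mul, Nat.cast_mul]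
  have h1 : (K₁ : ℝ) ≠ 0 := by positivity
  have h2 : (K₂ : ℝ) ≠ 0 := by positivity
  field_simp

/-! ### Lipschitz kernels -/

theorem IsLipschitzKernel.nonneg {L : ℝ} {c : Square × Square → ℝ} (h : IsLipschitzKernel L c) :
    0 ≤ L := by
  have h1 := (abs_nonneg _).trans (h ((0, 0), (0, 0)) ((1, 0), (0, 0)))
  simpa using h1

/-- The factor √2 appears because each grid direction contributes two of the four coordinates. -/
theorem IsLipschitzKernel.abs_sub_le {L : ℝ} {c : Square × Square → ℝ}
    (h : IsLipschitzKernel L c) {K₁ K₂ : ℕ} {s : ℝ} (hs : 0 ≤ s) {z w : Square × Square}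
    (h1 : |(z.1.1 : ℝ) - w.1.1| ≤ s * (K₁ : ℝ)⁻¹) (h2 : |(z.1.2 : ℝ) - w.1.2| ≤ s * (K₂ : ℝ)⁻¹)
    (h3 : |(z.2.1 : ℝ) - w.2.1| ≤ s * (K₁ : ℝ)⁻¹) (h4 : |(z.2.2 : ℝ) - w.2.2| ≤ s * (K₂ : ℝ)⁻¹) :
    |c z - c w| ≤ √2 * L * √(1 / (K₁ : ℝ) ^ 2 + 1 / (K₂ : ℝ) ^ 2) * s := by
  have hsq : ((z.1.1 : ℝ) - w.1.1) ^ 2 + ((z.1.2 : ℝ) - w.1.2) ^ 2 + ((z.2.1 : ℝ) - w.2.1) ^ 2 +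
      ((z.2.2 : ℝ) - w.2.2) ^ 2 ≤ s ^ 2 * (2 * (1 / (K₁ : ℝ) ^ 2 + 1 / (K₂ : ℝ) ^ 2)) := by
    have key : ∀ {x a : ℝ}, |x| ≤ s * a → x ^ 2 ≤ s ^ 2 * a ^ 2 := fun {x a} hx => by
      rw [← mul_pow, ← sq_abs x]
      exact pow_le_pow_left₀ (abs_nonneg x) hx 2
    have e1 := key h1
    have e2 := key h2
    have e3 := key h3
    have e4 := key h4
    rw [one_div, one_div, ← inv_pow, ← inv_pow]
    linarith
  calc |c z - c w| ≤ L * √(s ^ 2 * (2 * (1 / (K₁ : ℝ) ^ 2 + 1 / (K₂ : ℝ) ^ 2))) :=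
        (h z w).trans (mul_le_mul_of_nonneg_left (Real.sqrt_le_sqrt hsq) h.nonneg)
    _ = _ := by
      rw [Real.sqrt_mul (sq_nonneg s), Real.sqrt_sq hs, Real.sqrt_mul zero_le_two]
      ring

theorem abs_sub_le_of_mem_cell {K : ℕ} {i : Fin K} {t u : unitInterval} (ht : t ∈ cell K i)
    (hu : u ∈ cell K i) : |(t : ℝ) - u| ≤ 1 * (K : ℝ)⁻¹ := by
  have h1 := cell_subset ht
  have h2 := cell_subset hu
  rw [add_div, one_div] at h1 h2
  rw [abs_le]
  constructor <;> linarith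

theorem IsLipschitzKernel.abs_sub_le_of_mem_pixel {L : ℝ} {c : Square × Square → ℝ}
    (h : IsLipschitzKernel L c) {K₁ K₂ : ℕ} {p q : Fin K₁ × Fin K₂} {z w : Square × Square}
    (hz : z ∈ pixel K₁ K₂ p.1 p.2 ×ˢ pixel K₁ K₂ q.1 q.2)
    (hw : w ∈ pixel K₁ K₂ p.1 p.2 ×ˢ pixel K₁ K₂ q.1 q.2) :
    |c z - c w| ≤ √2 * L * √(1 / (K₁ : ℝ) ^ 2 + 1 / (K₂ : ℝ) ^ 2) := by
  have h1 := h.abs_sub_le (z := z) (w := w) zero_le_one (abs_sub_le_of_mem_cell hz.1.1 hw.1.1)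
    (abs_sub_le_of_mem_cell hz.1.2 hw.1.2) (abs_sub_le_of_mem_cell hz.2.1 hw.2.1)
    (abs_sub_le_of_mem_cell hz.2.2 hw.2.2)
  rwa [mul_one] at h1

/-! ### Pixelated kernels -/

/-- Every point lies in exactly one product of pixels, so the difference is at most `τ` almost
everywhere; the total measure is 1, so the same bound holds in L². -/
theorem norm_sum_smul_tensor_ind_sub_le {K₁ K₂ : ℕ} (hK₁ : 1 ≤ K₁) (hK₂ : 1 ≤ K₂) {C : HSKernel}
    {c : Square × Square → ℝ} (hker : C =ᵐ[volume] c)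
    {γ : Fin K₁ × Fin K₂ → Fin K₁ × Fin K₂ → ℝ} {τ : ℝ} (hτ : 0 ≤ τ)
    (h : ∀ p q, ∀ z ∈ pixel K₁ K₂ p.1 p.2 ×ˢ pixel K₁ K₂ q.1 q.2, |γ p q - c z| ≤ τ) :
    ‖∑ p, ∑ q, γ p q • tensor (ind (measurableSet_pixel K₁ K₂ p.1 p.2))
      (ind (measurableSet_pixel K₁ K₂ q.1 q.2)) - C‖ ≤ τ := by
  classical
  set e : Fin K₁ × Fin K₂ → LTwoSquare := fun p => ind (measurableSet_pixel K₁ K₂ p.1 p.2) with he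
  have hcoe : ∀ᵐ z ∂(volume : Measure (Square × Square)),
      ∀ r : (Fin K₁ × Fin K₂) × (Fin K₁ × Fin K₂),
      (γ r.1 r.2 • tensor (e r.1) (e r.2) : HSKernel) z =
        if z ∈ pixel K₁ K₂ r.1.1 r.1.2 ×ˢ pixel K₁ K₂ r.2.1 r.2.2 then γ r.1 r.2 else 0 := by
    rw [ae_all_iff]
    intro r
    filter_upwards [Lp.coeFn_smul (γ r.1 r.2) (tensor (e r.1) (e r.2)),
      (tensor_ind (measurableSet_pixel K₁ K₂ r.1.1 r.1.2)
        (measurableSet_pixel K₁ K₂ r.2.1 r.2.2)) ▸ indicatorConstLp_coeFn] with z h1 h2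
    rw [h1, Pi.smul_apply, h2]
    simp [Set.indicator]
  rw [← Fintype.sum_prod_type' (f := fun p q => γ p q • tensor (e p) (e q))]
  have hb := Lp.norm_le_of_ae_bound (μ := (volume : Measure (Square × Square))) (p := 2)
    (f := ∑ r : (Fin K₁ × Fin K₂) × (Fin K₁ × Fin K₂), γ r.1 r.2 • tensor (e r.1) (e r.2) - C)
    hτ ?_
  · have h1 : measureUnivNNReal (volume : Measure (Square × Square)) = 1 := by
      simp [measureUnivNNReal]
    rw [h1] at hb
    simpa using hb
  · filter_upwards [hcoe, hker,
      Lp.coeFn_sub (∑ r : (Fin K₁ × Fin K₂) × (Fin K₁ × Fin K₂),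
        γ r.1 r.2 • tensor (e r.1) (e r.2)) C,
      Lp.coeFn_finsetSum Finset.univ
        (fun r : (Fin K₁ × Fin K₂) × (Fin K₁ × Fin K₂) => γ r.1 r.2 • tensor (e r.1) (e r.2))]
      with z h1 h2 h3 h4
    obtain ⟨p, hp⟩ := exists_mem_pixel hK₁ hK₂ z.1
    obtain ⟨q, hq⟩ := exists_mem_pixel hK₁ hK₂ z.2
    rw [h3, Pi.sub_apply, h4, Finset.sum_apply, h2, Finset.sum_eq_single (p, q)]
    · rw [h1, if_pos ⟨hp, hq⟩]
      exact h p q z ⟨hp, hq⟩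
    · rintro ⟨p', q'⟩ - hne
      rw [h1, if_neg]
      rintro ⟨hp', hq'⟩
      refine hne (Prod.ext ?_ ?_)
      · by_contra hpp
        exact Set.disjoint_left.1 (disjoint_pixel hpp) hp' hp
      · by_contra hqq
        exact Set.disjoint_left.1 (disjoint_pixel hqq) hq' hq
    · exact fun h => absurd (Finset.mem_univ _) h

/-! ### Measurements as limits of local averages -/

/-- A family of subsets of the pixels which either do not depend on `k`, or shrink to a point at
the rate `1 / (k + 1)` relative to the size of the pixels. -/
structure IsSampling (K₁ K₂ : ℕ) (box : ℕ → Fin K₁ × Fin K₂ → Set Square) : Prop where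
  measurableSet : ∀ k p, MeasurableSet (box k p)
  subset : ∀ k p, box k p ⊆ pixel K₁ K₂ p.1 p.2
  measure_le : ∀ (k : ℕ) p, (volume : Measure Square).real (pixel K₁ K₂ p.1 p.2) ≤
    ((k : ℝ) + 1) ^ 2 * (volume : Measure Square).real (box k p)
  shrink : ∀ p, (∀ k, box k p = box 0 p) ∨ ∃ q : Square, ∀ k : ℕ, ∀ w ∈ box k p,
    |(w.1 : ℝ) - q.1| ≤ 1 / ((k : ℝ) + 1) * (K₁ : ℝ)⁻¹ ∧
    |(w.2 : ℝ) - q.2| ≤ 1 / ((k : ℝ) + 1) * (K₂ : ℝ)⁻¹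

namespace IsSampling

variable {K₁ K₂ : ℕ} {box : ℕ → Fin K₁ × Fin K₂ → Set Square}

theorem measureReal_ne_zero (h : IsSampling K₁ K₂ box) (k : ℕ) (p : Fin K₁ × Fin K₂) :
    (volume : Measure Square).real (box k p) ≠ 0 := by
  intro h0
  have h1 := h.measure_le k p
  have hK₁ : (0 : ℝ) < K₁ := by exact_mod_cast p.1.pos
  have hK₂ : (0 : ℝ) < K₂ := by exact_mod_cast p.2.pos
  rw [h0, measureReal_pixel, mul_zero] at h1
  exact absurd h1 (not_le.2 (by positivity))

variable {Ω : Type*} [MeasurableSpace Ω] {P : Measure Ω} {Z : Ω → LTwoSquare}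
  {L : ℝ} {c : Square × Square → ℝ}

/-- The square expands into four covariances with alternating signs, all close to the same value `c
(q, q)`, which cancels. Only four Lipschitz errors of order 1/(k + 1) remain. -/
theorem norm_pairing_sub_sq_le (h : IsSampling K₁ K₂ box) (hZ : MemLp Z 2 P)
    (hker : (∫ ω, tensor (Z ω) (Z ω) ∂P : HSKernel) =ᵐ[volume] c) (hLip : IsLipschitzKernel L c)
    (p : Fin K₁ × Fin K₂) {k l : ℕ} (hkl : k ≤ l) :
    ‖pairing hZ (avgVec (h.measurableSet l p)) - pairing hZ (avgVec (h.measurableSet k p))‖ ^ 2 ≤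
      6 * L * √(1 / (K₁ : ℝ) ^ 2 + 1 / (K₂ : ℝ) ^ 2) * (1 / ((k : ℝ) + 1)) := by
  have hL := hLip.nonneg
  rcases h.shrink p with h1 | ⟨q, hq⟩
  · have h2 : avgVec (h.measurableSet l p) = avgVec (h.measurableSet k p) := by
      have : box l p = box k p := by rw [h1 l, h1 k]
      congr 1
    rw [h2, sub_self, norm_zero, zero_pow two_ne_zero]
    positivity
  · have hq' : ∀ j, k ≤ j → ∀ w ∈ box j p,
        |(w.1 : ℝ) - q.1| ≤ 1 / ((k : ℝ) + 1) * (K₁ : ℝ)⁻¹ ∧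
        |(w.2 : ℝ) - q.2| ≤ 1 / ((k : ℝ) + 1) * (K₂ : ℝ)⁻¹ := by
      intro j hj w hw
      have h3 : 1 / ((j : ℝ) + 1) ≤ 1 / ((k : ℝ) + 1) := by gcongr
      exact ⟨(hq j w hw).1.trans (by gcongr), (hq j w hw).2.trans (by gcongr)⟩
    have key : ∀ i j, k ≤ i → k ≤ j →
        |⟪∫ ω, tensor (Z ω) (Z ω) ∂P, tensor (avgVec (h.measurableSet i p))
          (avgVec (h.measurableSet j p))⟫ - c (q, q)| ≤
          √2 * L * √(1 / (K₁ : ℝ) ^ 2 + 1 / (K₂ : ℝ) ^ 2) * (1 / ((k : ℝ) + 1)) := by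
      intro i j hi hj
      refine abs_inner_tensor_avgVec_sub_le hker _ _ (h.measureReal_ne_zero i p)
        (h.measureReal_ne_zero j p) fun z hz => ?_
      exact hLip.abs_sub_le (by positivity) (hq' i hi _ hz.1).1 (hq' i hi _ hz.1).2
        (hq' j hj _ hz.2).1 (hq' j hj _ hz.2).2
    have e1 := abs_le.1 (key l l hkl hkl)
    have e2 := abs_le.1 (key l k hkl le_rfl)
    have e3 := abs_le.1 (key k l le_rfl hkl)
    have e4 := abs_le.1 (key k k le_rfl le_rfl)
    rw [norm_pairing_sub_sq]
    -- Turns the four errors 4√2 into the constant 6.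
    have hs : √2 ≤ 3 / 2 := Real.sqrt_le_iff.2 ⟨by norm_num, by norm_num⟩
    set t := L * √(1 / (K₁ : ℝ) ^ 2 + 1 / (K₂ : ℝ) ^ 2) * (1 / ((k : ℝ) + 1)) with ht
    have ht0 : 0 ≤ t := by positivity
    have h4 : √2 * L * √(1 / (K₁ : ℝ) ^ 2 + 1 / (K₂ : ℝ) ^ 2) * (1 / ((k : ℝ) + 1)) = √2 * t := by
      rw [ht]; ring
    have h5 : 6 * L * √(1 / (K₁ : ℝ) ^ 2 + 1 / (K₂ : ℝ) ^ 2) * (1 / ((k : ℝ) + 1)) = 6 * t := by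
      rw [ht]; ring
    rw [h4] at e1 e2 e3 e4
    rw [h5]
    nlinarith

theorem tendsto_bound (L a : ℝ) :
    Tendsto (fun k : ℕ => 6 * L * a * (1 / ((k : ℝ) + 1))) atTop (𝓝 0) := by
  have := tendsto_one_div_add_atTop_nhds_zero_nat.const_mul (6 * L * a)
  rwa [mul_zero] at this

theorem abs_inner_sub_le_of_tendsto (h : IsSampling K₁ K₂ box) (hZ : MemLp Z 2 P)
    (hker : (∫ ω, tensor (Z ω) (Z ω) ∂P : HSKernel) =ᵐ[volume] c) (hLip : IsLipschitzKernel L c)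
    {z : Fin K₁ × Fin K₂ → Lp ℝ 2 P}
    (hz : ∀ p, Tendsto (fun k => pairing hZ (avgVec (h.measurableSet k p))) atTop (𝓝 (z p)))
    (p q : Fin K₁ × Fin K₂) {w : Square × Square}
    (hw : w ∈ pixel K₁ K₂ p.1 p.2 ×ˢ pixel K₁ K₂ q.1 q.2) :
    |⟪z p, z q⟫ - c w| ≤ √2 * L * √(1 / (K₁ : ℝ) ^ 2 + 1 / (K₂ : ℝ) ^ 2) := by
  refine le_of_tendsto ((((hz p).inner (𝕜 := ℝ) (hz q)).sub_const (c w)).abs)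
    (Eventually.of_forall fun k => ?_)
  rw [inner_pairing]
  refine abs_inner_tensor_avgVec_sub_le hker _ _ (h.measureReal_ne_zero k p)
    (h.measureReal_ne_zero k q) fun v hv => ?_
  exact hLip.abs_sub_le_of_mem_pixel ⟨h.subset k p hv.1, h.subset k q hv.2⟩ hw

/-- Weighting by pixels instead of boxes costs the area ratio, at most (k + 1)²; the rest is the
projection bound. The constant does not involve the grid. -/
theorem norm_sum_inner_avgVec_smul_ind_sq_le (h : IsSampling K₁ K₂ box) (k : ℕ) (x : LTwoSquare) :
    ‖∑ p, ⟪avgVec (h.measurableSet k p), x⟫ • ind (measurableSet_pixel K₁ K₂ p.1 p.2)‖ ^ 2 ≤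
      ((k : ℝ) + 1) ^ 2 * ‖x‖ ^ 2 := by
  rw [norm_sq_sum_smul_ind _ disjoint_pixel]
  have h1 := sum_measure_mul_inner_avgVec_sq_le (fun p => h.measurableSet k p)
    (fun p q hpq => (disjoint_pixel hpq).mono (h.subset k p) (h.subset k q)) x
  refine le_trans ?_ (mul_le_mul_of_nonneg_left h1 (sq_nonneg _))
  rw [Finset.mul_sum]
  refine Finset.sum_le_sum fun p _ => ?_
  rw [← mul_assoc]
  exact mul_le_mul_of_nonneg_right (h.measure_le k p) (sq_nonneg _)

end IsSampling

theorem pixelate_eq_sum_smul_ind {K₁ K₂ : ℕ} (M : Matrix (Fin K₁) (Fin K₂) ℝ) :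
    pixelate M = ∑ p : Fin K₁ × Fin K₂, M p.1 p.2 • ind (measurableSet_pixel K₁ K₂ p.1 p.2) :=
  (Fintype.sum_prod_type'
    (f := fun i j => M i j • ind (measurableSet_pixel K₁ K₂ i j))).symm

section Expansion

variable {Ω : Type*} [MeasurableSpace Ω] {P : Measure Ω} {ι : Type*} [Fintype ι]

theorem integral_lp_mul (z w : Lp ℝ 2 P) : ∫ ω, z ω * w ω ∂P = ⟪z, w⟫ := by
  rw [L2.inner_def]
  refine integral_congr_ae (Eventually.of_forall fun ω => ?_)
  simp [mul_comm]

theorem integrable_lp_mul (z w : Lp ℝ 2 P) : Integrable (fun ω => z ω * w ω) P :=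
  (Lp.memLp z).integrable_mul (Lp.memLp w)

theorem memLp_sum_smul_const (z : ι → Lp ℝ 2 P) (e : ι → LTwoSquare) :
    MemLp (fun ω => ∑ i, z i ω • e i) 2 P :=
  memLp_finsetSum _ fun i _ =>
    (ContinuousLinearMap.toSpanSingleton ℝ (e i)).comp_memLp' (Lp.memLp (z i))

theorem integral_sum_smul_const [IsProbabilityMeasure P] (z : ι → Lp ℝ 2 P) (e : ι → LTwoSquare)
    (h0 : ∀ i, ∫ ω, z i ω ∂P = 0) : ∫ ω, ∑ i, z i ω • e i ∂P = 0 := by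
  have hint : ∀ i, Integrable (fun ω => z i ω) P := fun i => (Lp.memLp (z i)).integrable one_le_two
  rw [integral_finsetSum _ fun i _ => (hint i).smul_const (e i)]
  refine Finset.sum_eq_zero fun i _ => ?_
  rw [integral_smul_const, h0, zero_smul]

theorem integral_tensor_sum_smul_const (z : ι → Lp ℝ 2 P) (e : ι → LTwoSquare) :
    ∫ ω, tensor (∑ i, z i ω • e i) (∑ i, z i ω • e i) ∂P =
      ∑ i, ∑ j, ⟪z i, z j⟫ • tensor (e i) (e j) := by
  have h1 : ∀ ω, tensor (∑ i, z i ω • e i) (∑ i, z i ω • e i) =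
      ∑ i, ∑ j, (z i ω * z j ω) • tensor (e i) (e j) := by
    intro ω
    rw [← tensorL_apply, map_sum tensorL, _root_.sum_apply]
    refine Finset.sum_congr rfl fun i _ => ?_
    rw [map_sum]
    refine Finset.sum_congr rfl fun j _ => ?_
    rw [tensorL_apply, tensor_smul_left, tensor_smul_right, smul_smul]
  simp only [h1]
  rw [integral_finsetSum _ fun i _ => integrable_finsetSum _ fun j _ =>
    (integrable_lp_mul (z i) (z j)).smul_const _]
  refine Finset.sum_congr rfl fun i _ => ?_
  rw [integral_finsetSum _ fun j _ => (integrable_lp_mul (z i) (z j)).smul_const _]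
  refine Finset.sum_congr rfl fun j _ => ?_
  rw [integral_smul_const, integral_lp_mul]

end Expansion

section Discretization

variable {Ω : Type*} [MeasurableSpace Ω] {P : Measure Ω} {X : ℕ → Ω → LTwoSquare}

/-- Makes the measurements almost surely one fixed function of the surface, the same for all `n`, so
that independence and identical distribution pass to them. -/
theorem ae_limUnder_eq {K₁ K₂ : ℕ} {box : ℕ → Fin K₁ × Fin K₂ → Set Square}
    (h : IsSampling K₁ K₂ box) {D : ℕ → Ω → Matrix (Fin K₁) (Fin K₂) ℝ}
    (hD : ∀ n, ∀ᵐ ω ∂P, ∀ p : Fin K₁ × Fin K₂,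
      Tendsto (fun k => ⟪avgVec (h.measurableSet k p), X n ω⟫) atTop (𝓝 (D n ω p.1 p.2))) (n : ℕ) :
    ∀ᵐ ω ∂P, ∀ p : Fin K₁ × Fin K₂,
      limUnder atTop (fun k => ⟪avgVec (h.measurableSet k p), X n ω⟫) = D n ω p.1 p.2 := by
  filter_upwards [hD n] with ω hω p
  exact (hω p).limUnder_eq

/-- The pixelated measurements are, up to a constant, a centered function `F` of the surface, which
is close to a Lipschitz function `G` of the surface and whose covariance is close to that of the
surface. -/
theorem IsSampling.exists_discretization [IsProbabilityMeasure P] {K₁ K₂ : ℕ} (hK₁ : 1 ≤ K₁) (hK₂ : 1 ≤ K₂)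
    {box : ℕ → Fin K₁ × Fin K₂ → Set Square} (h : IsSampling K₁ K₂ box)
    (hL2 : MemLp (X 0) 2 P) {L : ℝ} {c : Square × Square → ℝ}
    (hker : SeparableCov.covariance P (X 0) =ᵐ[volume] c) (hLip : IsLipschitzKernel L c)
    {D : ℕ → Ω → Matrix (Fin K₁) (Fin K₂) ℝ}
    (hD : ∀ n, ∀ᵐ ω ∂P, ∀ p : Fin K₁ × Fin K₂,
      Tendsto (fun k => ⟪avgVec (h.measurableSet k p), X n ω⟫) atTop (𝓝 (D n ω p.1 p.2)))
    (k : ℕ) :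
    ∃ F G : LTwoSquare → LTwoSquare, StronglyMeasurable F ∧ StronglyMeasurable G ∧
      (∃ a, ∀ n, ∀ᵐ ω ∂P, pixelate (D n ω) = F (X n ω) + a) ∧
      MemLp (fun ω => F (X 0 ω)) 2 P ∧ ∫ ω, F (X 0 ω) ∂P = 0 ∧
      (∀ ω, ‖G (X 0 ω)‖ ^ 2 ≤ ((k : ℝ) + 1) ^ 2 * ‖X 0 ω - ∫ ω', X 0 ω' ∂P‖ ^ 2) ∧
      ∫ ω, ‖F (X 0 ω) - G (X 0 ω)‖ ^ 2 ∂P ≤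
        6 * L * √(1 / (K₁ : ℝ) ^ 2 + 1 / (K₂ : ℝ) ^ 2) * (1 / ((k : ℝ) + 1)) ∧
      ‖∫ ω, tensor (F (X 0 ω)) (F (X 0 ω)) ∂P - SeparableCov.covariance P (X 0)‖ ≤
        √2 * L * √(1 / (K₁ : ℝ) ^ 2 + 1 / (K₂ : ℝ) ^ 2) := by
  have hL := hLip.nonneg
  set μ := ∫ ω', X 0 ω' ∂P with hμ
  set Z : Ω → LTwoSquare := fun ω => X 0 ω - μ with hZdef
  have hZ : MemLp Z 2 P := hL2.sub (memLp_const μ)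
  have hZ0 : ∫ ω, Z ω ∂P = 0 := by
    rw [hZdef, integral_sub (hL2.integrable one_le_two) (integrable_const _)]
    simp [hμ]
  have hker' : (∫ ω, tensor (Z ω) (Z ω) ∂P : HSKernel) =ᵐ[volume] c := hker
  have hcov : ∫ ω, tensor (Z ω) (Z ω) ∂P = SeparableCov.covariance P (X 0) := rfl
  set e : Fin K₁ × Fin K₂ → LTwoSquare := fun p => ind (measurableSet_pixel K₁ K₂ p.1 p.2) with he
  set b : ℕ → Fin K₁ × Fin K₂ → LTwoSquare := fun l p => avgVec (h.measurableSet l p) with hb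
  have hlim := fun p => exists_tendsto_of_norm_sub_sq_le
    (IsSampling.tendsto_bound L (√(1 / (K₁ : ℝ) ^ 2 + 1 / (K₂ : ℝ) ^ 2)))
    (fun i j hij => h.norm_pairing_sub_sq_le hZ hker' hLip p hij)
  choose z hz hzle using hlim
  -- The junk value of `limUnder` off the convergence set is harmless: the limit is a measurable
  -- function everywhere and equals the measurement almost surely.
  set f : Fin K₁ × Fin K₂ → LTwoSquare → ℝ := fun p x => limUnder atTop fun l => ⟪b l p, x⟫ with hf
  have hfm : ∀ p, StronglyMeasurable (f p) := fun p =>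
    StronglyMeasurable.limUnder fun l =>
      (continuous_const.inner continuous_id).stronglyMeasurable
  have hfD := ae_limUnder_eq h hD
  have hconst := fun p => exists_eq_sub_const_of_tendsto hZ (μ := μ) (f := fun ω => f p (X 0 ω))
    (hz p) (by
      filter_upwards [hD 0, hfD 0] with ω h1 h2
      have h3 := h1 p
      rw [← h2 p] at h3
      simpa only [hZdef, sub_add_cancel] using h3)
  choose m hm using hconst
  have hall : ∀ᵐ ω ∂P, ∀ p, z p ω = f p (X 0 ω) - m p := ae_all_iff.2 hm
  set F : LTwoSquare → LTwoSquare := fun x => ∑ p, (f p x - m p) • e p with hF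
  -- The limit in `F` is replaced by the `k`-th average, which is bounded by the norm of `x - μ`.
  set G : LTwoSquare → LTwoSquare := fun x => ∑ p, ⟪b k p, x - μ⟫ • e p with hG
  have hFz : (fun ω => F (X 0 ω)) =ᵐ[P] fun ω => ∑ p, z p ω • e p := by
    filter_upwards [hall] with ω hω
    simp only [hF, hω]
  refine ⟨F, G, ?_, ?_, ⟨∑ p, m p • e p, fun n => ?_⟩, ?_, ?_, ?_, ?_, ?_⟩
  · exact Finset.stronglyMeasurable_fun_sum _ fun p _ =>
      ((hfm p).sub stronglyMeasurable_const).smul_const _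
  · exact Finset.stronglyMeasurable_fun_sum _ fun p _ =>
      (continuous_const.inner (continuous_id.sub continuous_const)).stronglyMeasurable.smul_const _
  · filter_upwards [hfD n] with ω hω
    rw [pixelate_eq_sum_smul_ind, hF, ← Finset.sum_add_distrib]
    refine Finset.sum_congr rfl fun p _ => ?_
    rw [← add_smul, sub_add_cancel, ← hω p]
  · exact (memLp_congr_ae hFz).2 (memLp_sum_smul_const z e)
  · rw [integral_congr_ae hFz]
    exact integral_sum_smul_const z e fun p =>
      integral_eq_zero_of_tendsto (hz p) fun l => integral_pairing hZ hZ0 _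
  · exact fun ω => h.norm_sum_inner_avgVec_smul_ind_sq_le k _
  · have hpair : ∀ᵐ ω ∂P, ∀ p, (z p - pairing hZ (b k p) : Lp ℝ 2 P) ω =
        f p (X 0 ω) - m p - ⟪b k p, X 0 ω - μ⟫ := by
      rw [ae_all_iff]
      intro p
      filter_upwards [hm p, pairing_coeFn hZ (b k p), Lp.coeFn_sub (z p) (pairing hZ (b k p))]
        with ω h1 h2 h3
      rw [h3, Pi.sub_apply, h1, h2]
    have hFG : (fun ω => ‖F (X 0 ω) - G (X 0 ω)‖ ^ 2) =ᵐ[P] fun ω =>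
        ∑ p, (volume : Measure Square).real (pixel K₁ K₂ p.1 p.2) *
          ((z p - pairing hZ (b k p) : Lp ℝ 2 P) ω * (z p - pairing hZ (b k p) : Lp ℝ 2 P) ω) := by
      filter_upwards [hpair] with ω hω
      simp only [hF, hG, ← Finset.sum_sub_distrib, ← sub_smul]
      rw [norm_sq_sum_smul_ind _ disjoint_pixel]
      simp only [hω, sq]
    rw [integral_congr_ae hFG, integral_finsetSum _ fun p _ =>
      (integrable_lp_mul _ _).const_mul _]
    simp only [integral_const_mul, integral_lp_mul, real_inner_self_eq_norm_sq]
    refine (Finset.sum_le_sum fun p _ =>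
      mul_le_mul_of_nonneg_left (hzle p k) measureReal_nonneg).trans ?_
    rw [← Finset.sum_mul, sum_measureReal_pixel hK₁ hK₂, one_mul]
  · have hT : ∫ ω, tensor (F (X 0 ω)) (F (X 0 ω)) ∂P = ∑ p, ∑ q, ⟪z p, z q⟫ • tensor (e p) (e q) := by
      rw [← integral_tensor_sum_smul_const]
      refine integral_congr_ae ?_
      filter_upwards [hFz] with ω hω
      rw [hω]
    rw [hT]
    exact norm_sum_smul_tensor_ind_sub_le hK₁ hK₂ hker (by positivity) fun p q w hw =>
      h.abs_inner_sub_le_of_tendsto hZ hker' hLip hz p q hw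

end Discretization

/-! ### The two measurement schemes -/

theorem abs_inner_avgVec_sub_le {x : LTwoSquare} {g : Square → ℝ} (hx : x =ᵐ[volume] g)
    {B : Set Square} (hB : MeasurableSet B) (hB0 : (volume : Measure Square).real B ≠ 0) {v τ : ℝ}
    (h : ∀ w ∈ B, |g w - v| ≤ τ) : |⟪avgVec hB, x⟫ - v| ≤ τ := by
  set b := (volume : Measure Square).real B with hb
  have hbpos : 0 < b := measureReal_nonneg.lt_of_ne' hB0
  have hxi : IntegrableOn (fun w => x w) B volume :=
    ((Lp.memLp x).integrable one_le_two).integrableOn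
  have h2 : ∫ w in B, (x w - v) = (∫ w in B, x w) - b * v := by
    rw [integral_sub hxi (integrableOn_const (measure_ne_top _ _)), setIntegral_const, smul_eq_mul]
  have h3 : ‖∫ w in B, (x w - v)‖ ≤ τ * b := by
    refine norm_setIntegral_le_of_norm_le_const_ae' (measure_lt_top _ _) ?_
    filter_upwards [hx] with w hw hwB
    rw [hw]
    exact h w hwB
  have h4 : ⟪avgVec hB, x⟫ - v = b⁻¹ * ∫ w in B, (x w - v) := by
    rw [inner_avgVec, h2, mul_sub, inv_mul_cancel_left₀ hB0]
  rw [h4, abs_mul, abs_of_pos (inv_pos.2 hbpos), inv_mul_le_iff₀ hbpos, mul_comm b]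
  exact h3

theorem tendsto_inner_avgVec {x : LTwoSquare} {g : C(Square, ℝ)} (hx : x =ᵐ[volume] g)
    {B : ℕ → Set Square} (hB : ∀ k, MeasurableSet (B k))
    (hB0 : ∀ k, (volume : Measure Square).real (B k) ≠ 0) {q : Square}
    (hq : ∀ k : ℕ, ∀ w ∈ B k, |(w.1 : ℝ) - q.1| ≤ 1 / ((k : ℝ) + 1) ∧
      |(w.2 : ℝ) - q.2| ≤ 1 / ((k : ℝ) + 1)) :
    Tendsto (fun k => ⟪avgVec (hB k), x⟫) atTop (𝓝 (g q)) := by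
  rw [Metric.tendsto_atTop']
  intro ε hε
  obtain ⟨δ, hδ, hδε⟩ := Metric.continuousAt_iff.1 g.continuous.continuousAt (ε / 2) (half_pos hε)
  obtain ⟨k₀, hk₀⟩ := exists_nat_one_div_lt hδ
  refine ⟨k₀, fun k hk => ?_⟩
  have h1 : 1 / ((k : ℝ) + 1) < δ := lt_of_le_of_lt (by gcongr) hk₀
  have h2 := abs_inner_avgVec_sub_le hx (hB k) (hB0 k) (v := g q) (τ := ε / 2) fun w hw => by
    have h3 : dist w q < δ := by
      rw [Prod.dist_eq, max_lt_iff]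
      exact ⟨lt_of_le_of_lt (hq k w hw).1 h1, lt_of_le_of_lt (hq k w hw).2 h1⟩
    exact (hδε h3).le
  rw [Real.dist_eq]
  linarith

theorem isSampling_pixel (K₁ K₂ : ℕ) :
    IsSampling K₁ K₂ fun _ p => pixel K₁ K₂ p.1 p.2 where
  measurableSet _ p := measurableSet_pixel K₁ K₂ p.1 p.2
  subset _ _ := subset_rfl
  measure_le k p := le_mul_of_one_le_left measureReal_nonneg
    (one_le_pow₀ (by linarith [k.cast_nonneg (α := ℝ)]))
  shrink _ := Or.inl fun _ => rfl

/-- The part of a pixel near its measurement point. -/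
def subpixel (t s : (K : ℕ) → Fin K → unitInterval) (K₁ K₂ k : ℕ) (p : Fin K₁ × Fin K₂) :
    Set Square :=
  subcell K₁ p.1 (t K₁ p.1) (1 / ((k : ℝ) + 1) * (K₁ : ℝ)⁻¹) ×ˢ
    subcell K₂ p.2 (s K₂ p.2) (1 / ((k : ℝ) + 1) * (K₂ : ℝ)⁻¹)

theorem abs_sub_le_of_mem_subpixel {t s : (K : ℕ) → Fin K → unitInterval} {K₁ K₂ k : ℕ}
    {p : Fin K₁ × Fin K₂} {w : Square} (hw : w ∈ subpixel t s K₁ K₂ k p) :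
    |(w.1 : ℝ) - t K₁ p.1| ≤ 1 / ((k : ℝ) + 1) * (K₁ : ℝ)⁻¹ ∧
    |(w.2 : ℝ) - s K₂ p.2| ≤ 1 / ((k : ℝ) + 1) * (K₂ : ℝ)⁻¹ :=
  ⟨hw.1.2, hw.2.2⟩

theorem isSampling_subpixel {t s : (K : ℕ) → Fin K → unitInterval} (ht : IsGridChoice t)
    (hs : IsGridChoice s) (K₁ K₂ : ℕ) : IsSampling K₁ K₂ (subpixel t s K₁ K₂) where
  measurableSet _ _ := (measurableSet_subcell _ _ _ _).prod (measurableSet_subcell _ _ _ _)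
  subset _ _ := Set.prod_mono Set.inter_subset_left Set.inter_subset_left
  measure_le k p := by
    have hk : 1 / ((k : ℝ) + 1) ≤ 1 :=
      (div_le_one (by positivity)).2 (by linarith [k.cast_nonneg (α := ℝ)])
    have key : ∀ {K : ℕ} {u : (K : ℕ) → Fin K → unitInterval}, IsGridChoice u → ∀ i : Fin K,
        1 / ((k : ℝ) + 1) * (K : ℝ)⁻¹ ≤ (volume : Measure unitInterval).real
          (subcell K i (u K i) (1 / ((k : ℝ) + 1) * (K : ℝ)⁻¹)) := fun {K u} hu i =>
      le_measureReal_subcell (by positivity) (mul_le_of_le_one_left (by positivity) hk)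
        (hu K i).1 (hu K i).2
    have hprod : (volume : Measure Square).real (subpixel t s K₁ K₂ k p) =
        (volume : Measure unitInterval).real
          (subcell K₁ p.1 (t K₁ p.1) (1 / ((k : ℝ) + 1) * (K₁ : ℝ)⁻¹)) *
        (volume : Measure unitInterval).real
          (subcell K₂ p.2 (s K₂ p.2) (1 / ((k : ℝ) + 1) * (K₂ : ℝ)⁻¹)) :=
      measureReal_prod_prod _ _
    rw [hprod, measureReal_pixel]
    calc (K₁ : ℝ)⁻¹ * (K₂ : ℝ)⁻¹ = ((k : ℝ) + 1) ^ 2 *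
          ((1 / ((k : ℝ) + 1) * (K₁ : ℝ)⁻¹) * (1 / ((k : ℝ) + 1) * (K₂ : ℝ)⁻¹)) := by
          have : (k : ℝ) + 1 ≠ 0 := by positivity
          field_simp
      _ ≤ _ := by
        gcongr
        · exact key ht p.1
        · exact key hs p.2
  shrink p := Or.inr ⟨(t K₁ p.1, s K₂ p.2), fun _ _ hw => abs_sub_le_of_mem_subpixel hw⟩

section Schemes

variable {Ω : Type*} [MeasurableSpace Ω] {P : Measure Ω} {X : ℕ → Ω → LTwoSquare}
  {D : (K₁ K₂ : ℕ) → ℕ → Ω → Matrix (Fin K₁) (Fin K₂) ℝ}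

theorem AverageScheme.ae_tendsto (h : AverageScheme P X D) (K₁ K₂ n : ℕ) :
    ∀ᵐ ω ∂P, ∀ p : Fin K₁ × Fin K₂,
      Tendsto (fun k => ⟪avgVec ((isSampling_pixel K₁ K₂).measurableSet k p), X n ω⟫) atTop
        (𝓝 (D K₁ K₂ n ω p.1 p.2)) := by
  filter_upwards [h n] with ω hω p
  rw [hω]
  simp only [inner_avgVec]
  exact tendsto_const_nhds

theorem PointwiseScheme.ae_tendsto {t s : (K : ℕ) → Fin K → unitInterval}
    (h : PointwiseScheme P X t s D) (ht : IsGridChoice t) (hs : IsGridChoice s) (K₁ K₂ n : ℕ) :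
    ∀ᵐ ω ∂P, ∀ p : Fin K₁ × Fin K₂,
      Tendsto (fun k => ⟪avgVec ((isSampling_subpixel ht hs K₁ K₂).measurableSet k p), X n ω⟫)
        atTop (𝓝 (D K₁ K₂ n ω p.1 p.2)) := by
  filter_upwards [h n] with ω ⟨x, hx, hω⟩ p
  rw [hω]
  have hinv : ∀ {K : ℕ} (_ : Fin K) (k : ℕ),
      1 / ((k : ℝ) + 1) * (K : ℝ)⁻¹ ≤ 1 / ((k : ℝ) + 1) := fun {K} i k => by
    have hK : (1 : ℝ) ≤ K := by exact_mod_cast i.pos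
    exact mul_le_of_le_one_right (by positivity) (inv_le_one_of_one_le₀ hK)
  exact tendsto_inner_avgVec hx _ (fun k => (isSampling_subpixel ht hs K₁ K₂).measureReal_ne_zero k p)
    (q := (t K₁ p.1, s K₂ p.2)) fun k w hw =>
      ⟨(abs_sub_le_of_mem_subpixel hw).1.trans (hinv p.1 k),
        (abs_sub_le_of_mem_subpixel hw).2.trans (hinv p.2 k)⟩

end Schemes

/-! ### Rate of convergence -/

section Rate

variable {Ω : Type*} [MeasurableSpace Ω] {P : Measure Ω} [IsProbabilityMeasure P]
  {X : ℕ → Ω → LTwoSquare}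

/-- The empirical covariance of the pixelated surfaces estimates the covariance uniformly in the
size of the grid, up to a discretization error. -/
theorem exists_prob_norm_empiricalCov_sub_le (hindep : iIndepFun X P)
    (hident : ∀ n, IdentDistrib (X n) (X 0) P P) (hmoment : MemLp (X 0) 4 P)
    {L : ℝ} {c : Square × Square → ℝ}
    (hker : SeparableCov.covariance P (X 0) =ᵐ[volume] c) (hLip : IsLipschitzKernel L c)
    {D : (K₁ K₂ : ℕ) → ℕ → Ω → Matrix (Fin K₁) (Fin K₂) ℝ}
    {box : (K₁ K₂ : ℕ) → ℕ → Fin K₁ × Fin K₂ → Set Square}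
    (hbox : ∀ K₁ K₂, IsSampling K₁ K₂ (box K₁ K₂))
    (hD : ∀ K₁ K₂ n, ∀ᵐ ω ∂P, ∀ p : Fin K₁ × Fin K₂,
      Tendsto (fun k => ⟪avgVec ((hbox K₁ K₂).measurableSet k p), X n ω⟫) atTop
        (𝓝 (D K₁ K₂ n ω p.1 p.2))) {ε : ℝ} (hε : 0 < ε) :
    ∃ M : ℝ, 0 ≤ M ∧ ∀ N K₁ K₂ : ℕ, 1 ≤ N → 1 ≤ K₁ → 1 ≤ K₂ →
      P.real {ω | (√2 + 1) * L * √(1 / (K₁ : ℝ) ^ 2 + 1 / (K₂ : ℝ) ^ 2) + M / √(N : ℝ) <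
        ‖empiricalCov N (fun n => pixelate (D K₁ K₂ n ω)) - SeparableCov.covariance P (X 0)‖} ≤
          ε := by
  have hL := hLip.nonneg
  set δ := ε / 3 with hδ
  have hδ0 : 0 < δ := by positivity
  -- 48 = 8 * 6: the factor 8 in the smallness condition on the remainder times the 6 in its second
  -- moment. The choice depends on `ε` only, not on the grid.
  obtain ⟨k, hk⟩ := exists_nat_one_div_lt (show 0 < δ / 48 by positivity)
  set μ := ∫ ω', X 0 ω' ∂P with hμ
  have hX0 := (hident 0).aemeasurable_fst
  have hL2 : MemLp (X 0) 2 P := hmoment.mono_exponent (by norm_num)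
  have hZ2 : Integrable (fun ω => ‖X 0 ω - μ‖ ^ 2) P :=
    (hL2.sub (memLp_const μ)).integrable_norm_pow two_ne_zero
  have hZ4 : Integrable (fun ω => ‖X 0 ω - μ‖ ^ 4) P := by
    have h4 : MemLp (fun ω => X 0 ω - μ) ((4 : ℕ) : ENNReal) P := by
      exact_mod_cast hmoment.sub (memLp_const μ)
    exact h4.integrable_norm_pow four_ne_zero
  set V := ((k : ℝ) + 1) ^ 4 * ∫ ω, ‖X 0 ω - μ‖ ^ 4 ∂P with hV
  -- A grid-free bound for the second moment of `F`, from `G` and the remainder; η ≤ √2 on every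
  -- grid.
  set W := 2 * (((k : ℝ) + 1) ^ 2 * ∫ ω, ‖X 0 ω - μ‖ ^ 2 ∂P) + 2 * (6 * L * √2) with hW
  have hV0 : 0 ≤ V := mul_nonneg (by positivity) (integral_nonneg fun ω => by positivity)
  have hI2 : 0 ≤ ∫ ω, ‖X 0 ω - μ‖ ^ 2 ∂P := integral_nonneg fun ω => by positivity
  have hW0 : 0 ≤ W := by positivity
  have hquad : ∀ {U : ℝ}, 0 ≤ U → U ≤ δ * (1 + U / δ) ^ 2 := fun {U} hU => by
    have h1 : 1 + U / δ ≤ (1 + U / δ) ^ 2 := le_self_pow₀ (by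
      have : 0 ≤ U / δ := by positivity
      linarith) two_ne_zero
    calc U ≤ δ * (1 + U / δ) := by
          rw [mul_add, mul_div_cancel₀ _ hδ0.ne']
          linarith
      _ ≤ _ := by gcongr
  set M₁ := 1 + 16 * V / δ with hM₁
  set M₂ := 1 + W / δ with hM₂
  have hM₁0 : 0 < M₁ := by positivity
  have hM₂0 : 0 < M₂ := by positivity
  refine ⟨1 + (M₁ + M₂ ^ 2), by positivity, fun N K₁ K₂ hN hK₁ hK₂ => ?_⟩
  set η := √(1 / (K₁ : ℝ) ^ 2 + 1 / (K₂ : ℝ) ^ 2) with hη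
  have hη0 : 0 ≤ η := Real.sqrt_nonneg _
  have hη2 : η ≤ √2 := by
    refine Real.sqrt_le_sqrt ?_
    have key : ∀ {K : ℕ}, 1 ≤ K → 1 / (K : ℝ) ^ 2 ≤ 1 := fun {K} hK => by
      have h1 : (1 : ℝ) ≤ K := by exact_mod_cast hK
      exact (div_le_one (by positivity)).2 (one_le_pow₀ h1)
    linarith [key hK₁, key hK₂]
  have hN0 : (0 : ℝ) < √(N : ℝ) := Real.sqrt_pos.2 (by exact_mod_cast hN)
  obtain ⟨F, G, hFm, hGm, ⟨a, ha⟩, hFL, hF0, hG, hFG, hcov⟩ :=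
    (hbox K₁ K₂).exists_discretization hK₁ hK₂ hL2 hker hLip (hD K₁ K₂) k
  have hGX : AEStronglyMeasurable (fun ω => G (X 0 ω)) P :=
    hGm.aestronglyMeasurable.comp_aemeasurable hX0
  have hG2I : Integrable (fun ω => ‖G (X 0 ω)‖ ^ 2) P := by
    refine (hZ2.const_mul (((k : ℝ) + 1) ^ 2)).mono' (hGX.norm.pow 2)
      (Eventually.of_forall fun ω => ?_)
    rw [Real.norm_of_nonneg (by positivity)]
    exact hG ω
  have hG4 : ∀ ω, ‖G (X 0 ω)‖ ^ 4 ≤ ((k : ℝ) + 1) ^ 4 * ‖X 0 ω - μ‖ ^ 4 := fun ω => by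
    calc ‖G (X 0 ω)‖ ^ 4 = (‖G (X 0 ω)‖ ^ 2) ^ 2 := by ring
      _ ≤ (((k : ℝ) + 1) ^ 2 * ‖X 0 ω - μ‖ ^ 2) ^ 2 := pow_le_pow_left₀ (by positivity) (hG ω) 2
      _ = _ := by ring
  have hG4I : Integrable (fun ω => ‖G (X 0 ω)‖ ^ 4) P := by
    refine (hZ4.const_mul (((k : ℝ) + 1) ^ 4)).mono' (hGX.norm.pow 4)
      (Eventually.of_forall fun ω => ?_)
    rw [Real.norm_of_nonneg (by positivity)]
    exact hG4 ω
  have hGL : MemLp (fun ω => G (X 0 ω)) 2 P := (memLp_two_iff_integrable_sq_norm hGX).2 hG2I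
  have hk1 : 1 / ((k : ℝ) + 1) ≤ 1 :=
    (div_le_one (by positivity)).2 (by linarith [k.cast_nonneg (α := ℝ)])
  have hVle : ∫ ω, ‖G (X 0 ω)‖ ^ 4 ∂P ≤ V := by
    rw [hV, ← integral_const_mul]
    exact integral_mono hG4I (hZ4.const_mul _) hG4
  have hDI : Integrable (fun ω => ‖F (X 0 ω) - G (X 0 ω)‖ ^ 2) P :=
    (hFL.sub hGL).integrable_norm_pow two_ne_zero
  have hWle : ∫ ω, ‖F (X 0 ω)‖ ^ 2 ∂P ≤ W := by
    have h1 : ∫ ω, ‖F (X 0 ω)‖ ^ 2 ∂P ≤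
        ∫ ω, (2 * ‖G (X 0 ω)‖ ^ 2 + 2 * ‖F (X 0 ω) - G (X 0 ω)‖ ^ 2) ∂P := by
      refine integral_mono (hFL.integrable_norm_pow two_ne_zero)
        ((hG2I.const_mul 2).add (hDI.const_mul 2)) fun ω => ?_
      have h2 := norm_add_le (G (X 0 ω)) (F (X 0 ω) - G (X 0 ω))
      rw [add_sub_cancel] at h2
      have h3 := pow_le_pow_left₀ (norm_nonneg _) h2 2
      dsimp only
      nlinarith [sq_nonneg (‖G (X 0 ω)‖ - ‖F (X 0 ω) - G (X 0 ω)‖)]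
    rw [integral_add (hG2I.const_mul 2) (hDI.const_mul 2), integral_const_mul,
      integral_const_mul] at h1
    have h4 : ∫ ω, ‖G (X 0 ω)‖ ^ 2 ∂P ≤ ((k : ℝ) + 1) ^ 2 * ∫ ω, ‖X 0 ω - μ‖ ^ 2 ∂P := by
      rw [← integral_const_mul]
      exact integral_mono hG2I (hZ2.const_mul _) hG
    have h5 : 6 * L * η * (1 / ((k : ℝ) + 1)) ≤ 6 * L * √2 :=
      (mul_le_of_le_one_right (by positivity) hk1).trans (by gcongr)
    rw [hW]
    linarith
  -- `L * η` is what Markov needs for the remainder; the summand 1/√N keeps `τ` positive when L = 0.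
  set τ := L * η + 1 / √(N : ℝ) with hτ
  have hτ0 : 0 < τ := by positivity
  have hβ : 8 * (6 * L * η * (1 / ((k : ℝ) + 1))) ≤ δ * τ := by
    have h1 : L * η * (1 / ((k : ℝ) + 1)) ≤ L * η * (δ / 48) := by gcongr
    have h2 : L * η ≤ τ := by
      rw [hτ]
      linarith [one_div_pos.2 hN0]
    have h3 := mul_le_mul_of_nonneg_left h2 hδ0.le
    linarith
  have hmain := prob_empiricalCov_sub_le hindep hident hFm hGm hF0 hG4I hFL hGL hVle hWle hFG
    hM₁0 hM₂0 hτ0 (hquad (by positivity)) (hquad hW0) hβ hN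
  have hae : ∀ᵐ ω ∂P, ∀ n, pixelate (D K₁ K₂ n ω) = F (X n ω) + a := ae_all_iff.2 ha
  have hle : P.real {ω | (√2 + 1) * L * η + (1 + (M₁ + M₂ ^ 2)) / √(N : ℝ) <
        ‖empiricalCov N (fun n => pixelate (D K₁ K₂ n ω)) - SeparableCov.covariance P (X 0)‖} ≤
      P.real {ω | τ + (M₁ + M₂ ^ 2) / √N < ‖empiricalCov N (fun n => F (X n ω)) -
        ∫ ω', tensor (F (X 0 ω')) (F (X 0 ω')) ∂P‖} := by
    refine ENNReal.toReal_mono (measure_ne_top _ _) (measure_mono_ae ?_)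
    filter_upwards [hae] with ω hω h1
    change _ < _ at h1
    change _ < _
    simp only [hω] at h1
    rw [empiricalCov_add_const hN] at h1
    have h2 := norm_sub_le_norm_sub_add_norm_sub (empiricalCov N (fun n => F (X n ω)))
      (∫ ω', tensor (F (X 0 ω')) (F (X 0 ω')) ∂P) (SeparableCov.covariance P (X 0))
    rw [add_div] at h1
    rw [hτ]
    linarith
  refine hle.trans (hmain.trans (le_of_eq ?_))
  rw [hδ]
  ring

/-- The rate for the best separable approximations follows from the one for the empirical
covariance. -/
theorem exists_prob_abs_norm_sub_bias_le (hindep : iIndepFun X P)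
    (hident : ∀ n, IdentDistrib (X n) (X 0) P P) (hmoment : MemLp (X 0) 4 P)
    {σ : ℕ → ℝ} {A B : ℕ → LTwoSquare} (hscd : IsSCD (SeparableCov.covariance P (X 0)) σ A B)
    {L : ℝ} {c : Square × Square → ℝ}
    (hker : SeparableCov.covariance P (X 0) =ᵐ[volume] c) (hLip : IsLipschitzKernel L c)
    {D : (K₁ K₂ : ℕ) → ℕ → Ω → Matrix (Fin K₁) (Fin K₂) ℝ}
    {box : (K₁ K₂ : ℕ) → ℕ → Fin K₁ × Fin K₂ → Set Square}
    (hbox : ∀ K₁ K₂, IsSampling K₁ K₂ (box K₁ K₂))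
    (hD : ∀ K₁ K₂ n, ∀ᵐ ω ∂P, ∀ p : Fin K₁ × Fin K₂,
      Tendsto (fun k => ⟪avgVec ((hbox K₁ K₂).measurableSet k p), X n ω⟫) atTop
        (𝓝 (D K₁ K₂ n ω p.1 p.2)))
    {Chat : (R N K₁ K₂ : ℕ) → Ω → HSKernel}
    (hChat : ∀ R N K₁ K₂ ω, IsBestSepApprox R
      (empiricalCov N (fun n => pixelate (D K₁ K₂ n ω))) (Chat R N K₁ K₂ ω))
    {ε : ℝ} (hε : 0 < ε) :
    ∃ M : ℝ, ∀ R : ℕ, 1 ≤ R → (∀ i < R, σ (i + 1) < σ i) →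
      ∀ N K₁ K₂ : ℕ, 1 ≤ N → 1 ≤ K₁ → 1 ≤ K₂ →
        P.real {ω |
          (16 * aConst (SeparableCov.covariance P (X 0)) σ R + √2) * L
              * √(1 / (K₁ : ℝ) ^ 2 + 1 / (K₂ : ℝ) ^ 2)
            + 8 * √2 * L ^ 2 / ‖SeparableCov.covariance P (X 0)‖
              * (1 / (K₁ : ℝ) ^ 2 + 1 / (K₂ : ℝ) ^ 2)
              * aConst (SeparableCov.covariance P (X 0)) σ R
            + M * (aConst (SeparableCov.covariance P (X 0)) σ R / √(N : ℝ))
          < |‖Chat R N K₁ K₂ ω - SeparableCov.covariance P (X 0)‖ - bias σ R|} ≤ ε := by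
  have hL := hLip.nonneg
  obtain ⟨M, hM, hprob⟩ :=
    exists_prob_norm_empiricalCov_sub_le hindep hident hmoment hker hLip hbox hD hε
  refine ⟨2 * M, fun R hR hσ N K₁ K₂ hN hK₁ hK₂ => ?_⟩
  -- The event need not be measurable; monotonicity of the outer measure is enough.
  refine (measureReal_mono fun ω hω => ?_).trans (hprob N K₁ K₂ hN hK₁ hK₂)
  have ha := hscd.one_le_aConst hR hσ
  have hbest := hscd.abs_norm_sub_sub_bias_le (hChat R N K₁ K₂ ω)
  rw [Set.mem_ofPred_eq] at hω ⊢
  set a := aConst (SeparableCov.covariance P (X 0)) σ R with hadef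
  set η := √(1 / (K₁ : ℝ) ^ 2 + 1 / (K₂ : ℝ) ^ 2) with hη
  have hη0 : 0 ≤ η := Real.sqrt_nonneg _
  have hquad : 0 ≤ 8 * √2 * L ^ 2 / ‖SeparableCov.covariance P (X 0)‖
      * (1 / (K₁ : ℝ) ^ 2 + 1 / (K₂ : ℝ) ^ 2) * a := by positivity
  have hMa : 2 * M * (1 / √(N : ℝ)) ≤ 2 * M * (a / √(N : ℝ)) := by gcongr
  have hs : √2 ≤ 3 / 2 := Real.sqrt_le_iff.2 ⟨by norm_num, by norm_num⟩
  -- This is where a ≥ 1 enters: 2(√2 + 1) ≤ 16 + √2.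
  have hlin : 2 * ((√2 + 1) * (L * η)) ≤ (16 * a + √2) * (L * η) := by
    have h1 : 2 * (√2 + 1) ≤ 16 * a + √2 := by linarith
    nlinarith [mul_nonneg hL hη0]
  have hdiv : M / √(N : ℝ) = M * (1 / √(N : ℝ)) := by ring
  rw [hdiv, mul_assoc]
  rw [mul_assoc _ L η] at hω
  linarith

end Rate

end SeparableCov

theorem theorem2 {Ω : Type*} [MeasurableSpace Ω] (P : MeasureTheory.Measure Ω)
    [MeasureTheory.IsProbabilityMeasure P]
    -- the i.i.d. random surfaces, with finite fourth moment
    (X : ℕ → Ω → SeparableCov.LTwoSquare)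
    (hindep : ProbabilityTheory.iIndepFun X P)
    (hident : ∀ n, ProbabilityTheory.IdentDistrib (X n) (X 0) P P)
    (hmoment : MeasureTheory.MemLp (X 0) 4 P)
    -- the separable component decomposition of the covariance
    (σ : ℕ → ℝ) (A B : ℕ → SeparableCov.LTwoSquare)
    (hscd : SeparableCov.IsSCD (SeparableCov.covariance P (X 0)) σ A B)
    -- the covariance has an `L`-Lipschitz kernel `c`
    (L : ℝ) (c : SeparableCov.Square × SeparableCov.Square → ℝ)
    (hker : SeparableCov.covariance P (X 0) =ᵐ[MeasureTheory.volume] c)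
    (hLip : SeparableCov.IsLipschitzKernel L c)
    -- the measurements at grid size `K₁ × K₂`, by one of the two schemes
    (D : (K₁ K₂ : ℕ) → ℕ → Ω → Matrix (Fin K₁) (Fin K₂) ℝ)
    (hscheme :
      (∃ t s : (K : ℕ) → Fin K → unitInterval, SeparableCov.IsGridChoice t ∧
        SeparableCov.IsGridChoice s ∧ SeparableCov.PointwiseScheme P X t s D) ∨
      SeparableCov.AverageScheme P X D)
    -- the estimator: a best `R`-separable approximation of the empirical covariance of the
    -- pixelated surfaces
    (Chat : (R N K₁ K₂ : ℕ) → Ω → SeparableCov.HSKernel)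
    (hChat : ∀ R N K₁ K₂ ω, SeparableCov.IsBestSepApprox R
      (SeparableCov.empiricalCov N (fun n => SeparableCov.pixelate (D K₁ K₂ n ω)))
      (Chat R N K₁ K₂ ω)) :
    ∀ ε : ℝ, 0 < ε → ∃ M : ℝ, ∀ R : ℕ, 1 ≤ R → (∀ i < R, σ (i + 1) < σ i) →
      ∀ N K₁ K₂ : ℕ, 1 ≤ N → 1 ≤ K₁ → 1 ≤ K₂ →
        P.real {ω |
          (16 * SeparableCov.aConst (SeparableCov.covariance P (X 0)) σ R + √2) * L
              * √(1 / (K₁ : ℝ) ^ 2 + 1 / (K₂ : ℝ) ^ 2)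
            + 8 * √2 * L ^ 2 / ‖SeparableCov.covariance P (X 0)‖
              * (1 / (K₁ : ℝ) ^ 2 + 1 / (K₂ : ℝ) ^ 2)
              * SeparableCov.aConst (SeparableCov.covariance P (X 0)) σ R
            + M * (SeparableCov.aConst (SeparableCov.covariance P (X 0)) σ R / √(N : ℝ))
          < |‖Chat R N K₁ K₂ ω - SeparableCov.covariance P (X 0)‖ - SeparableCov.bias σ R|} ≤ ε := by
  intro ε hε
  rcases hscheme with ⟨t, s, ht, hs, h⟩ | h
  · exact SeparableCov.exists_prob_abs_norm_sub_bias_le hindep hident hmoment hscd hker hLip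
      (fun K₁ K₂ => SeparableCov.isSampling_subpixel ht hs K₁ K₂)
      (fun K₁ K₂ n => h.ae_tendsto ht hs K₁ K₂ n) hChat hε
  · exact SeparableCov.exists_prob_abs_norm_sub_bias_le hindep hident hmoment hscd hker hLip
      (fun K₁ K₂ => SeparableCov.isSampling_pixel K₁ K₂)
      (fun K₁ K₂ n => h.ae_tendsto K₁ K₂ n) hChat hε
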